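/- Let $\sigma=\{s\in\mathbb C:\operatorname{Re}s=\tfrac12\}$. For complex-valued $f\in L_2(\mathbb R_+)$ let $f^*(s)=\int_0^\infty f(t)t^{s-1}\,dt$, $s\in\sigma$, be its Mellin transform, where the integral is the limit in $L_2(\sigma)$ of the integrals over $[1/N,N]$ as $N\to\infty$. For a function $F$ on $\sigma$ such that $\tau\mapsto F(\frac12+i\tau)$ is locally integrable, the formula $f(x)=\frac1{2\pi i}\int_\sigma F(s)x^{-s}\,ds$ in the mean square sense means that the integrals over $\{\frac12+i\tau:|\tau|\le N\}$ converge to $f$ in $L_2(\mathbb R_+)$ as $N\to\infty$. Singular integrals are Cauchy principal values (the limit as $\varepsilon\to0^+$ of the integral over the $t>0$ at distance greater than $\varepsilon$ from the singular point), and an equation is said to be solved by $f$ if, for almost all $x>0$, the principal value exists and the equation holds. For every $f\in L_2(\mathbb R_+)$ the following four conditions are equivalent: (a) $f$ solves $\displaystyle\frac1x f\Big(\frac1x\Big)=\frac2\pi\,\mathrm{PV}\!\int_0^\infty\frac{t f(t)}{t^2-x^2}\,dt$, $x>0$; (b) $f$ solves $\displaystyle f(x)=\frac2\pi\,\mathrm{PV}\!\int_0^\infty\frac{xt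 f(t)}{x^2t^2-1}\,dt$, $x>0$; (c) there is a function $\varphi$ on $\sigma$ with $\varphi(s)=\varphi(1-s)$ for all $s\in\sigma$ such that $\displaystyle f(x)=\frac1{2\pi i}\int_\sigma\frac{\varphi(s)}{\cos(\pi s/2)}x^{-s}\,ds$ in the mean square sense; (d) there is a function $\varphi$ on $\sigma$ with $\varphi(s)=\varphi(1-s)$ for all $s\in\sigma$ such that $f^*(s)=\varphi(s)/\cos(\pi s/2)$ for almost all $s\in\sigma$. Analogously, for every $f\in L_2(\mathbb R_+)$ the following four conditions are equivalent: (a') $f$ solves $\displaystyle\frac1x f\Big(\frac1x\Big)=\frac2\pi\,\mathrm{PV}\!\int_0^\infty\frac{x f(t)}{x^2-t^2}\,dt$, $x>0$; (b') $f$ solves $\displaystyle f(x)=\frac2\pi\,\mathrm{PV}\!\int_0^\infty\frac{f(t)}{1-x^2t^2}\,dt$, $x>0$; (c') there is a function $\rho$ on $\sigma$ with $\rho(s)=\rho(1-s)$ for all $s\in\sigma$ such that $\displaystyle f(x)=\frac1{2\pi i}\int_\sigma\frac{\rho(s)}{\sin(\pi s/2)}x^{-s}\,ds$ in the mean square sense;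 (d') there is a function $\rho$ on $\sigma$ with $\rho(s)=\rho(1-s)$ for all $s\in\sigma$ such that $f^*(s)=\rho(s)/\sin(\pi s/2)$ for almost all $s\in\sigma$. -/

import Mathlib

open MeasureTheory Filter Topology Set

/-- The point `1/2 + i τ` of the critical line. -/
noncomputable def critPt (τ : ℝ) : ℂ := 1 / 2 + (τ : ℂ) * Complex.I

/-- `f` belongs to (complex) `L₂` of the half-line `(0, ∞)`; values of `f` elsewhere are ignored. -/
def MemL2HalfLine (f : ℝ → ℂ) : Prop := MemLp f 2 (volume.restrict (Ioi (0 : ℝ)))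

/-- The Cauchy principal value of `∫₀^∞ k(t) dt`, with a singularity at `t = a`, exists and
equals `v`: the integrals over `{t > 0 : |t - a| > ε}` converge absolutely and tend to `v`
as `ε → 0+`. -/
def HasPVIntegral (k : ℝ → ℂ) (a : ℝ) (v : ℂ) : Prop :=
  (∀ ε : ℝ, 0 < ε → IntegrableOn k {t : ℝ | 0 < t ∧ ε < |t - a|}) ∧
  Tendsto (fun ε : ℝ => ∫ t in {t : ℝ | 0 < t ∧ ε < |t - a|}, k t) (𝓝[>] 0) (𝓝 v)

/-- `(1/x) f(1/x) = (2/π) PV ∫₀^∞ t f(t) / (t² - x²) dt` for almost all `x > 0`. -/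
def SolvesReflectedCot (f : ℝ → ℂ) : Prop :=
  ∀ᵐ x : ℝ ∂(volume.restrict (Ioi (0 : ℝ))), ∃ v : ℂ,
    HasPVIntegral (fun t => (t : ℂ) * f t / ((t : ℂ) ^ 2 - (x : ℂ) ^ 2)) x v ∧
    1 / (x : ℂ) * f (1 / x) = 2 / (Real.pi : ℂ) * v

/-- `(1/x) f(1/x) = (2/π) PV ∫₀^∞ x f(t) / (x² - t²) dt` for almost all `x > 0`. -/
def SolvesReflectedTan (f : ℝ → ℂ) : Prop :=
  ∀ᵐ x : ℝ ∂(volume.restrict (Ioi (0 : ℝ))), ∃ v : ℂ,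
    HasPVIntegral (fun t => (x : ℂ) * f t / ((x : ℂ) ^ 2 - (t : ℂ) ^ 2)) x v ∧
    1 / (x : ℂ) * f (1 / x) = 2 / (Real.pi : ℂ) * v

/-- `f(x) = (2/π) PV ∫₀^∞ x t f(t) / (x² t² - 1) dt` for almost all `x > 0`
(the singularity is at `t = 1/x`). -/
def SolvesSecondKindCot (f : ℝ → ℂ) : Prop :=
  ∀ᵐ x : ℝ ∂(volume.restrict (Ioi (0 : ℝ))), ∃ v : ℂ,
    HasPVIntegral (fun t => (x : ℂ) * (t : ℂ) * f t / ((x : ℂ) ^ 2 * (t : ℂ) ^ 2 - 1)) (1 / x) v ∧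
    f x = 2 / (Real.pi : ℂ) * v

/-- `f(x) = (2/π) PV ∫₀^∞ f(t) / (1 - x² t²) dt` for almost all `x > 0`
(the singularity is at `t = 1/x`). -/
def SolvesSecondKindTan (f : ℝ → ℂ) : Prop :=
  ∀ᵐ x : ℝ ∂(volume.restrict (Ioi (0 : ℝ))), ∃ v : ℂ,
    HasPVIntegral (fun t => f t / (1 - (x : ℂ) ^ 2 * (t : ℂ) ^ 2)) (1 / x) v ∧
    f x = 2 / (Real.pi : ℂ) * v

/-- `F`, restricted to the line `Re s = 1/2`, is the `L₂` Mellin transform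
`f*(s) = ∫₀^∞ f(t) t^(s-1) dt` of `f`: it is square integrable on that line, and the integrals
over `[1/N, N]` tend to it in mean square as `N → ∞`. -/
def IsMellinTransformL2 (f : ℝ → ℂ) (F : ℂ → ℂ) : Prop :=
  MemLp (fun τ : ℝ => F (critPt τ)) 2 volume ∧
  Tendsto (fun N : ℝ => eLpNorm (fun τ : ℝ =>
      (∫ t in Icc (1 / N) N, f t * (t : ℂ) ^ (critPt τ - 1)) - F (critPt τ)) 2 volume)
    atTop (𝓝 0)

/-- `f(x) = (1/(2πi)) ∫_σ F(s) x^(-s) ds`, the integral over the line `σ : Re s = 1/2` being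
convergent in the mean square sense: `F` is locally integrable on `σ`, and the integrals over
`{1/2 + iτ : |τ| ≤ N}` (with `ds = i dτ`) tend to `f` in `L₂(0, ∞)` as `N → ∞`. -/
def IsMeanSquareMellinIntegral (F : ℂ → ℂ) (f : ℝ → ℂ) : Prop :=
  LocallyIntegrable (fun τ : ℝ => F (critPt τ)) volume ∧
  Tendsto (fun N : ℝ => eLpNorm (fun x : ℝ =>
      f x - 1 / (2 * (Real.pi : ℂ)) * ∫ τ in Icc (-N) N, F (critPt τ) * (x : ℂ) ^ (-critPt τ))
        2 (volume.restrict (Ioi (0 : ℝ))))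
    atTop (𝓝 0)

/-- `φ(s) = φ(1 - s)` on the line `Re s = 1/2`. -/
def SymmetricOnCritLine (φ : ℂ → ℂ) : Prop := ∀ s : ℂ, s.re = 1 / 2 → φ s = φ (1 - s)

/-!
The substitution `t = e^{-u}` turns the Mellin transform on `Re s = 1/2` into the `L²` Fourier
transform, so that conditions (c) and (d) both say that `f*(s) cos (π s / 2)`, respectively
`f*(s) sin (π s / 2)`, is symmetric under `s ↦ 1 - s`.

Since `2t / (t² - x²) = 1 / (t - x) + 1 / (t + x)` and `2x / (x² - t²) = 1 / (x - t) + 1 / (x + t)`,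
the two reflected equations say that `f(1/x)/x` is, up to sign, the Hilbert transform `H` of the
odd, respectively even, extension of `f`. The harmonic extensions of `a` and `H a` to the upper
half-plane are conjugate, and by parity their values on the imaginary axis are integrals over the
half-line: `∫₀^∞ p(t) t / (t² + ε²) dt = ∫₀^∞ q(t) ε / (t² + ε²) dt` for all `ε > 0`, where
`(p, q) = (f, -H f)` in the odd case and `(H f, f)` in the even case. In the variable `u` both
sides are correlations with `e^{-w/2} / (e^w + e^{-w})`, whose Fourier transform is
`(π / 2) / cos (π s / 2)` by the reflection formula for the Beta function. Hence `H` acts on Mellin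
transforms as an explicit quotient of `cos (π s / 2)` and `sin (π s / 2)`, and the equation for `f`
becomes the symmetry.
-/

open scoped ENNReal FourierTransform SchwartzMap

section FourierL2

variable {V : Type*} [NormedAddCommGroup V] [InnerProductSpace ℝ V] [FiniteDimensional ℝ V]
  [MeasurableSpace V] [BorelSpace V]

theorem ae_eq_of_integral_schwartz_mul_eq {a b : V → ℂ} (ha : LocallyIntegrable a)
    (hb : LocallyIntegrable b) (h : ∀ ψ : 𝓢(V, ℂ), ∫ x, ψ x * a x = ∫ x, ψ x * b x) :
    a =ᵐ[volume] b := by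
  refine ae_eq_of_integral_contDiff_smul_eq ha hb fun g hg hc => ?_
  have hcs : HasCompactSupport (Complex.ofRealCLM ∘ g) := hc.comp_left rfl
  have hsmooth : ContDiff ℝ ((⊤ : ℕ∞) : WithTop ℕ∞) (Complex.ofRealCLM ∘ g) := by fun_prop
  simpa using h (hcs.toSchwartzMap hsmooth)

theorem locallyIntegrable_coe_L2 (a : V →₂[volume] ℂ) : LocallyIntegrable a :=
  (Lp.memLp a).locallyIntegrable one_le_two

theorem continuous_fourier_of_integrable {h : V → ℂ} (hh : Integrable h) : Continuous (𝓕 h) :=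
  VectorFourier.fourierIntegral_continuous Real.continuous_fourierChar continuous_inner hh

theorem continuous_fourierInv_of_integrable {h : V → ℂ} (hh : Integrable h) :
    Continuous (𝓕⁻ h) := by
  have : 𝓕⁻ h = fun x => 𝓕 h (-x) := funext fun x => Real.fourierInv_eq_fourier_neg h x
  exact this ▸ (continuous_fourier_of_integrable hh).comp continuous_neg

theorem integral_schwartz_mul_fourier (a : V →₂[volume] ℂ) (ψ : 𝓢(V, ℂ)) :
    ∫ x, ψ x * (𝓕 a : V →₂[volume] ℂ) x = ∫ x, 𝓕 ψ x * a x := by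
  have h := congrArg (fun T => T ψ) (Lp.fourier_toTemperedDistribution_eq a)
  simp only [TemperedDistribution.fourier_apply, Lp.toTemperedDistribution_apply, smul_eq_mul] at h
  exact h.symm

theorem integral_fourier_mul_eq {a b : V → ℂ} (ha : Integrable a) (hb : Integrable b) :
    ∫ x, 𝓕 a x * b x = ∫ x, a x * 𝓕 b x := by
  have h := VectorFourier.integral_fourierIntegral_smul_eq_flip (L := innerₗ V)
    Real.continuous_fourierChar continuous_inner ha hb
  simp only [flip_innerₗ, smul_eq_mul] at h
  exact h

theorem fourier_toLp_ae_eq {h : V → ℂ} (h1 : Integrable h) (h2 : MemLp h 2) :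
    (𝓕 (h2.toLp h) : V →₂[volume] ℂ) =ᵐ[volume] 𝓕 h := by
  refine ae_eq_of_integral_schwartz_mul_eq (locallyIntegrable_coe_L2 _)
    (continuous_fourier_of_integrable h1).locallyIntegrable fun ψ => ?_
  rw [integral_schwartz_mul_fourier, ← integral_fourier_mul_eq ψ.integrable h1,
    SchwartzMap.fourier_coe]
  refine integral_congr_ae ?_
  filter_upwards [h2.coeFn_toLp] with x hx
  rw [hx]

theorem ae_eq_fourier_of_fourierInv_ae_eq {G : V → ℂ} (hG : Integrable G)
    (b : V →₂[volume] ℂ) (hb : 𝓕⁻ G =ᵐ[volume] b) :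
    G =ᵐ[volume] (𝓕 b : V →₂[volume] ℂ) := by
  refine ae_eq_of_integral_schwartz_mul_eq hG.locallyIntegrable (locallyIntegrable_coe_L2 _)
    fun ψ => ?_
  have hψ : ∀ x, 𝓕 ψ x = (𝓕⁻ ψ : 𝓢(V, ℂ)) (-x) := fun x => by
    rw [SchwartzMap.fourier_coe, SchwartzMap.fourierInv_coe, Real.fourierInv_eq_fourier_neg,
      neg_neg]
  calc ∫ x, ψ x * G x = ∫ x, 𝓕 (𝓕⁻ ψ : 𝓢(V, ℂ)) x * G x := by
        rw [FourierTransform.fourier_fourierInv_eq]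
    _ = ∫ x, (𝓕⁻ ψ : 𝓢(V, ℂ)) x * 𝓕 G x := by
        rw [SchwartzMap.fourier_coe, integral_fourier_mul_eq (𝓕⁻ ψ).integrable hG]
    _ = ∫ x, (𝓕⁻ ψ : 𝓢(V, ℂ)) (-x) * 𝓕 G (-x) :=
        (integral_neg_eq_self (fun x => (𝓕⁻ ψ : 𝓢(V, ℂ)) x * 𝓕 G x) volume).symm
    _ = ∫ x, 𝓕 ψ x * 𝓕⁻ G x := by simp only [hψ, Real.fourierInv_eq_fourier_neg]
    _ = ∫ x, 𝓕 ψ x * b x := integral_congr_ae (hb.mono fun x hx => by simp only [hx])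
    _ = ∫ x, ψ x * (𝓕 b : V →₂[volume] ℂ) x := (integral_schwartz_mul_fourier b ψ).symm

theorem fourierInv_toLp_ae_eq {h : V → ℂ} (h1 : Integrable h) (h2 : MemLp h 2) :
    𝓕⁻ h =ᵐ[volume] (𝓕⁻ (h2.toLp h) : V →₂[volume] ℂ) := by
  have hn : MemLp (fun x => h (-x)) 2 :=
    h2.comp_measurePreserving (Measure.measurePreserving_neg volume)
  have e1 : 𝓕⁻ h =ᵐ[volume] (𝓕 (hn.toLp _) : V →₂[volume] ℂ) := by
    rw [Real.fourierInv_eq_fourier_comp_neg]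
    exact (fourier_toLp_ae_eq h1.comp_neg hn).symm
  have e2 : h2.toLp h = 𝓕 (𝓕 (hn.toLp _) : V →₂[volume] ℂ) :=
    Lp.ext (h2.coeFn_toLp.trans (ae_eq_fourier_of_fourierInv_ae_eq h1 _ e1))
  rwa [e2, FourierTransform.fourierInv_fourier_eq]

theorem ae_eq_of_fourierInv_eq {F G : V → ℂ} (hF : Integrable F) (hG : Integrable G)
    (h : ∀ x, 𝓕⁻ F x = 𝓕⁻ G x) : F =ᵐ[volume] G := by
  have hsub : 𝓕⁻ (F - G) = 0 := funext fun x => by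
    have hx := h x
    simp only [Real.fourierInv_eq_fourier_neg, Real.fourier_eq, Pi.sub_apply, smul_sub,
      Pi.zero_apply] at hx ⊢
    rw [integral_sub ((Real.fourierIntegral_convergent_iff _).2 hF)
      ((Real.fourierIntegral_convergent_iff _).2 hG), hx, sub_self]
  have hzero : 𝓕 (0 : V →₂[volume] ℂ) = 0 := (Lp.fourierTransformₗᵢ V ℂ).map_zero
  have hFG := ae_eq_fourier_of_fourierInv_ae_eq (hF.sub hG) 0
    (hsub ▸ (Lp.coeFn_zero ℂ 2 volume).symm)
  rw [hzero] at hFG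
  exact (hFG.trans (Lp.coeFn_zero _ _ _)).mono fun x => sub_eq_zero.1

theorem continuous_integral_mul_left (b : V →₂[volume] ℂ) :
    Continuous fun a : V →₂[volume] ℂ => ∫ x, b x * a x := by
  refine (((ContinuousLinearMap.mul ℂ ℂ).lpPairing volume 2 2) b).continuous.congr fun a => ?_
  simpa using ContinuousLinearMap.lpPairing_eq_integral (ContinuousLinearMap.mul ℂ ℂ) b a

theorem integral_mul_fourier_eq (a b : V →₂[volume] ℂ) :
    ∫ x, b x * (𝓕 a : V →₂[volume] ℂ) x = ∫ x, (𝓕 b : V →₂[volume] ℂ) x * a x := by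
  refine DenseRange.induction_on (p := fun a : V →₂[volume] ℂ =>
      ∫ x, b x * (𝓕 a : V →₂[volume] ℂ) x = ∫ x, (𝓕 b : V →₂[volume] ℂ) x * a x)
    (SchwartzMap.denseRange_toLpCLM (p := 2) ENNReal.ofNat_ne_top) a ?_ fun ψ => ?_
  · exact isClosed_eq ((continuous_integral_mul_left b).comp
      (Lp.fourierTransformₗᵢ V ℂ).continuous) (continuous_integral_mul_left _)
  · rw [SchwartzMap.toLpCLM_apply, SchwartzMap.toLp_fourier_eq ψ]
    calc ∫ x, b x * (𝓕 ψ).toLp 2 volume x = ∫ x, 𝓕 ψ x * b x :=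
          integral_congr_ae (by
            filter_upwards [(𝓕 ψ).coeFn_toLp 2] with x hx using by rw [hx, mul_comm])
      _ = ∫ x, ψ x * (𝓕 b : V →₂[volume] ℂ) x := (integral_schwartz_mul_fourier b ψ).symm
      _ = ∫ x, (𝓕 b : V →₂[volume] ℂ) x * ψ.toLp 2 volume x :=
          integral_congr_ae (by
            filter_upwards [ψ.coeFn_toLp 2] with x hx using by rw [hx, mul_comm])

theorem integral_mul_fourier_eq_of_integrable (a : V →₂[volume] ℂ) {h : V → ℂ}
    (h1 : Integrable h) (h2 : MemLp h 2) :
    ∫ x, a x * 𝓕 h x = ∫ x, (𝓕 a : V →₂[volume] ℂ) x * h x := by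
  calc ∫ x, a x * 𝓕 h x
      = ∫ x, a x * (𝓕 (h2.toLp h) : V →₂[volume] ℂ) x :=
        integral_congr_ae ((fourier_toLp_ae_eq h1 h2).mono fun x hx => by simp only [hx])
    _ = ∫ x, (𝓕 a : V →₂[volume] ℂ) x * h2.toLp h x := integral_mul_fourier_eq _ _
    _ = _ := integral_congr_ae (h2.coeFn_toLp.mono fun x hx => by simp only [hx])

theorem fourier_comp_linearIsometryEquiv_ae_eq (A : V ≃ₗᵢ[ℝ] V) {a b : V →₂[volume] ℂ}
    (h : b =ᵐ[volume] a ∘ A) :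
    (𝓕 b : V →₂[volume] ℂ) =ᵐ[volume] (𝓕 a : V →₂[volume] ℂ) ∘ A := by
  have hA := A.measurePreserving
  have hA' := A.symm.measurePreserving
  refine ae_eq_of_integral_schwartz_mul_eq (locallyIntegrable_coe_L2 _)
    (((Lp.memLp _).comp_measurePreserving hA).locallyIntegrable one_le_two) fun ψ => ?_
  have hψ1 : Integrable (ψ ∘ A.symm) := hA'.integrable_comp_of_integrable ψ.integrable
  have hψ2 : MemLp (ψ ∘ A.symm) 2 := (ψ.memLp 2).comp_measurePreserving hA'
  calc ∫ x, ψ x * (𝓕 b : V →₂[volume] ℂ) x = ∫ x, 𝓕 ψ x * b x := integral_schwartz_mul_fourier b ψ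
    _ = ∫ x, 𝓕 ψ (A.symm (A x)) * a (A x) :=
        integral_congr_ae (h.mono fun x hx => by simp [hx])
    _ = ∫ x, a x * 𝓕 (ψ ∘ A.symm) x := by
        rw [hA.integral_comp A.toHomeomorph.measurableEmbedding fun x => 𝓕 ψ (A.symm x) * a x]
        simp only [Real.fourier_comp_linearIsometry, SchwartzMap.fourier_coe, mul_comm]
    _ = ∫ x, (𝓕 a : V →₂[volume] ℂ) x * ψ (A.symm x) :=
        integral_mul_fourier_eq_of_integrable a hψ1 hψ2
    _ = ∫ x, ψ x * (𝓕 a : V →₂[volume] ℂ) (A x) := by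
        rw [← hA.integral_comp A.toHomeomorph.measurableEmbedding]
        simp only [A.symm_apply_apply, mul_comm]

theorem fourier_exp_mul_eq_sub (K : V → ℂ) (u v : V) :
    𝓕 (fun ξ => Complex.exp (↑(2 * Real.pi * inner ℝ ξ v) * Complex.I) * K ξ) u = 𝓕 K (u - v) := by
  rw [Real.fourier_eq', Real.fourier_eq']
  congr 1 with ξ
  rw [smul_eq_mul, smul_eq_mul, ← mul_assoc, ← Complex.exp_add, inner_sub_right]
  push_cast
  ring_nf

theorem integral_mul_fourier_sub_eq (a : V →₂[volume] ℂ) {K : V → ℂ} (h1 : Integrable K)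
    (h2 : MemLp K 2) (v : V) :
    ∫ u, a u * 𝓕 K (u - v) = 𝓕⁻ (fun ξ => (𝓕 a : V →₂[volume] ℂ) ξ * K ξ) v := by
  have hexp : Continuous fun ξ : V =>
      Complex.exp (↑(2 * Real.pi * inner ℝ ξ v) * Complex.I) := by fun_prop
  have hnorm : ∀ ξ : V,
      ‖Complex.exp (↑(2 * Real.pi * inner ℝ ξ v) * Complex.I) * K ξ‖ = ‖K ξ‖ := fun ξ => by
    rw [norm_mul, Complex.norm_exp_ofReal_mul_I, one_mul]
  have hm : AEStronglyMeasurable (fun ξ =>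
      Complex.exp (↑(2 * Real.pi * inner ℝ ξ v) * Complex.I) * K ξ) volume :=
    hexp.aestronglyMeasurable.mul h1.aestronglyMeasurable
  simp only [← fourier_exp_mul_eq_sub]
  rw [integral_mul_fourier_eq_of_integrable a (h1.congr' hm (.of_forall fun ξ => (hnorm ξ).symm))
    (h2.congr_norm hm (.of_forall fun ξ => (hnorm ξ).symm)), Real.fourierInv_eq']
  congr 1 with ξ
  rw [smul_eq_mul, mul_left_comm]

theorem fourier_mul_ae_eq_of_integral_eq {a b : V →₂[volume] ℂ} {K₁ K₂ : V → ℂ}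
    (hK₁ : Integrable K₁) (hK₁' : MemLp K₁ 2) (hK₂ : Integrable K₂) (hK₂' : MemLp K₂ 2)
    (h : ∀ v, ∫ u, a u * 𝓕 K₁ (u - v) = ∫ u, b u * 𝓕 K₂ (u - v)) :
    (fun ξ => (𝓕 a : V →₂[volume] ℂ) ξ * K₁ ξ) =ᵐ[volume]
      fun ξ => (𝓕 b : V →₂[volume] ℂ) ξ * K₂ ξ := by
  refine ae_eq_of_fourierInv_eq ((Lp.memLp _).integrable_mul hK₁')
    ((Lp.memLp _).integrable_mul hK₂') fun v => ?_
  rw [← integral_mul_fourier_sub_eq a hK₁ hK₁', ← integral_mul_fourier_sub_eq b hK₂ hK₂', h v]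

end FourierL2

section PoissonKernel

/-- The Poisson kernel of the upper half-plane at height `ε`, without the factor `1 / π`. -/
noncomputable def poissonKer (ε w : ℝ) : ℝ := ε / (w ^ 2 + ε ^ 2)

/-- The conjugate Poisson kernel of the upper half-plane at height `ε`, without the factor
`1 / π`. -/
noncomputable def conjPoissonKer (ε w : ℝ) : ℝ := w / (w ^ 2 + ε ^ 2)

/-- The kernel `1 / w` of the Hilbert transform truncated at distance `ε` from its singularity,
without the factor `1 / π`. -/
noncomputable def truncKer (ε w : ℝ) : ℝ := if ε < |w| then 1 / w else 0

variable {ε : ℝ}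

theorem poissonKer_pos (hε : 0 < ε) (w : ℝ) : 0 < poissonKer ε w := by
  rw [poissonKer]; positivity

theorem poissonKer_le_inv (hε : 0 < ε) (w : ℝ) : poissonKer ε w ≤ ε⁻¹ := by
  rw [poissonKer, inv_eq_one_div, div_le_div_iff₀ (by positivity) hε]
  nlinarith [sq_nonneg w]

theorem continuous_poissonKer (hε : 0 < ε) : Continuous (poissonKer ε) :=
  continuous_const.div (by fun_prop) fun w => by positivity

theorem continuous_conjPoissonKer (hε : 0 < ε) : Continuous (conjPoissonKer ε) :=
  continuous_id.div (by fun_prop) fun w => by positivity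

theorem measurable_truncKer (ε : ℝ) : Measurable (truncKer ε) :=
  Measurable.ite (measurableSet_lt measurable_const measurable_norm)
    (measurable_const.div measurable_id) measurable_const

theorem poissonKer_eq (hε : 0 < ε) (w : ℝ) : poissonKer ε w = ε⁻¹ * (1 + (w / ε) ^ 2)⁻¹ := by
  rw [poissonKer]; field_simp; ring

theorem integrable_poissonKer (hε : 0 < ε) : Integrable (poissonKer ε) := by
  simp only [funext (poissonKer_eq hε)]
  exact (integrable_inv_one_add_sq.comp_div hε.ne').const_mul _

theorem integral_poissonKer (hε : 0 < ε) : ∫ w, poissonKer ε w = Real.pi := by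
  simp only [poissonKer_eq hε]
  rw [integral_const_mul, Measure.integral_comp_div (fun w => (1 + w ^ 2)⁻¹),
    integral_univ_inv_one_add_sq, abs_of_pos hε, smul_eq_mul, inv_mul_cancel_left₀ hε.ne']

theorem conjPoissonKer_neg (ε w : ℝ) : conjPoissonKer ε (-w) = -conjPoissonKer ε w := by
  rw [conjPoissonKer, conjPoissonKer, neg_sq, neg_div]

theorem truncKer_neg (ε w : ℝ) : truncKer ε (-w) = -truncKer ε w := by
  rw [truncKer, truncKer, abs_neg]
  split_ifs
  · rw [div_neg]
  · rw [neg_zero]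

theorem abs_conjPoissonKer_sub_truncKer_le (hε : 0 < ε) (w : ℝ) :
    |conjPoissonKer ε w - truncKer ε w| ≤ poissonKer ε w := by
  have hden : 0 < w ^ 2 + ε ^ 2 := by positivity
  rw [conjPoissonKer, truncKer, poissonKer]
  split_ifs with h
  · have hw : w ≠ 0 := abs_pos.1 (hε.trans h)
    have hsub : w / (w ^ 2 + ε ^ 2) - 1 / w = -(ε ^ 2 / (w * (w ^ 2 + ε ^ 2))) := by
      field_simp; ring
    rw [hsub, abs_neg, abs_div, abs_mul, abs_of_pos hden, abs_of_pos (by positivity : 0 < ε ^ 2),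
      div_le_div_iff₀ (by positivity) hden]
    have : 0 < ε * (w ^ 2 + ε ^ 2) := by positivity
    nlinarith
  · rw [sub_zero, abs_div, abs_of_pos hden]
    gcongr
    exact not_lt.1 h

theorem conjPoissonKer_sq_le (hε : 0 < ε) (w : ℝ) :
    conjPoissonKer ε w ^ 2 ≤ ε⁻¹ * poissonKer ε w := by
  rw [conjPoissonKer, poissonKer, div_pow, inv_mul_eq_div, div_div, mul_comm (w ^ 2 + ε ^ 2) ε,
    div_le_div_iff₀ (by positivity) (by positivity)]
  have : 0 ≤ ε ^ 3 * (w ^ 2 + ε ^ 2) := by positivity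
  nlinarith

theorem memLp_two_of_sq_le_poissonKer {k : ℝ → ℝ} (hk : Measurable k) (hε : 0 < ε)
    (h : ∀ w, k w ^ 2 ≤ ε⁻¹ * poissonKer ε w) (x : ℝ) :
    MemLp (fun t => (k (x - t) : ℂ)) 2 := by
  have hm : Measurable fun t => k (x - t) := hk.comp (measurable_const.sub measurable_id)
  refine MemLp.ofReal ((memLp_two_iff_integrable_sq hm.aestronglyMeasurable).2 ?_)
  refine (((integrable_poissonKer hε).const_mul ε⁻¹).comp_sub_left x).mono'
    (hm.pow_const 2).aestronglyMeasurable (.of_forall fun t => ?_)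
  rw [Real.norm_of_nonneg (sq_nonneg _)]
  exact h _

theorem memLp_conjPoissonKer (hε : 0 < ε) (x : ℝ) :
    MemLp (fun t => (conjPoissonKer ε (x - t) : ℂ)) 2 :=
  memLp_two_of_sq_le_poissonKer (continuous_conjPoissonKer hε).measurable hε
    (conjPoissonKer_sq_le hε) x

theorem memLp_two_of_abs_le_poissonKer {k : ℝ → ℝ} (hk : Measurable k) (hε : 0 < ε)
    (h : ∀ w, |k w| ≤ poissonKer ε w) (x : ℝ) : MemLp (fun t => (k (x - t) : ℂ)) 2 := by
  refine memLp_two_of_sq_le_poissonKer hk hε (fun w => ?_) x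
  calc k w ^ 2 ≤ poissonKer ε w ^ 2 := sq_le_sq' (abs_le.1 (h w)).1 (abs_le.1 (h w)).2
    _ = poissonKer ε w * poissonKer ε w := sq _
    _ ≤ ε⁻¹ * poissonKer ε w :=
      mul_le_mul_of_nonneg_right (poissonKer_le_inv hε w) (poissonKer_pos hε w).le

theorem memLp_poissonKer (hε : 0 < ε) (x : ℝ) :
    MemLp (fun t => (poissonKer ε (x - t) : ℂ)) 2 :=
  memLp_two_of_abs_le_poissonKer (continuous_poissonKer hε).measurable hε
    (fun w => (abs_of_pos (poissonKer_pos hε w)).le) x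

theorem memLp_truncKer (hε : 0 < ε) (x : ℝ) : MemLp (fun t => (truncKer ε (x - t) : ℂ)) 2 := by
  have hsub := memLp_two_of_abs_le_poissonKer
    ((continuous_conjPoissonKer hε).measurable.sub (measurable_truncKer ε)) hε
    (abs_conjPoissonKer_sub_truncKer_le hε) x
  refine ((memLp_conjPoissonKer hε x).sub hsub).ae_eq (.of_forall fun t => ?_)
  simp

end PoissonKernel

section PoissonMeans

variable {ε : ℝ}

theorem exists_poissonKer_le_geometric (hε : 0 < ε) (w : ℝ) :
    ∃ k : ℕ, |w| ≤ 2 ^ k * ε ∧ poissonKer ε w ≤ 4 / ε * (1 / 4) ^ k := by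
  rcases le_total |w| ε with h | h
  · refine ⟨0, by simpa using h, (poissonKer_le_inv hε w).trans ?_⟩
    rw [pow_zero, mul_one, inv_eq_one_div]
    gcongr
    norm_num
  · obtain ⟨m, hm, hm'⟩ := exists_nat_pow_near ((one_le_div hε).2 h) one_lt_two
    rw [le_div_iff₀ hε] at hm
    refine ⟨m + 1, ((div_lt_iff₀ hε).1 hm').le, ?_⟩
    have hsq : (2 ^ m * ε) ^ 2 ≤ w ^ 2 := sq_abs w ▸ pow_le_pow_left₀ (by positivity) hm 2
    have hfour : (4 : ℝ) / ε * (1 / 4) ^ (m + 1) = ε / (2 ^ m * ε) ^ 2 := by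
      rw [one_div_pow, pow_succ, show (4 : ℝ) ^ m = 2 ^ m * 2 ^ m by rw [← mul_pow]; norm_num]
      field_simp
    rw [hfour, poissonKer]
    gcongr
    nlinarith [sq_nonneg ε]

theorem average_nonneg_of_nonneg {α : Type*} [MeasurableSpace α] {μ : Measure α} {g : α → ℝ}
    (hg : ∀ t, 0 ≤ g t) : 0 ≤ ⨍ t, g t ∂μ := by
  rw [average_eq]
  exact mul_nonneg (by positivity) (integral_nonneg hg)

theorem lintegral_mul_poissonKer_le {g : ℝ → ℝ} (hg0 : ∀ t, 0 ≤ g t) (hg : LocallyIntegrable g)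
    (x : ℝ) (hε : 0 < ε) :
    ∫⁻ t, ENNReal.ofReal (g t * poissonKer ε (x - t)) ≤
      ∑' k : ℕ, ENNReal.ofReal (8 * (1 / 2) ^ k * ⨍ t in Metric.closedBall x (2 ^ k * ε), g t) := by
  have hdyadic : ∀ t, ENNReal.ofReal (g t * poissonKer ε (x - t)) ≤
      ∑' k : ℕ, (Metric.closedBall x (2 ^ k * ε)).indicator
        (fun t => ENNReal.ofReal (4 / ε * (1 / 4) ^ k * g t)) t := fun t => by
    obtain ⟨k, hmem, hle⟩ := exists_poissonKer_le_geometric hε (x - t)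
    refine le_trans ?_ (ENNReal.le_tsum k)
    rw [abs_sub_comm] at hmem
    rw [indicator_of_mem (Metric.mem_closedBall.2 hmem), mul_comm]
    exact ENNReal.ofReal_le_ofReal (mul_le_mul_of_nonneg_right hle (hg0 t))
  have hball : ∀ k : ℕ, ∫ t in Metric.closedBall x (2 ^ k * ε), 4 / ε * (1 / 4) ^ k * g t =
      8 * (1 / 2) ^ k * ⨍ t in Metric.closedBall x (2 ^ k * ε), g t := fun k => by
    rw [integral_const_mul, setAverage_eq, Measure.real, Real.volume_closedBall,
      ENNReal.toReal_ofReal (by positivity), smul_eq_mul, one_div_pow, one_div_pow,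
      show (4 : ℝ) ^ k = 2 ^ k * 2 ^ k by rw [← mul_pow]; norm_num]
    field_simp
    ring
  refine (lintegral_mono hdyadic).trans_eq ?_
  rw [lintegral_tsum fun k => ((hg.aestronglyMeasurable.aemeasurable.const_mul _).ennreal_ofReal
    |>.indicator measurableSet_closedBall)]
  congr 1 with k
  rw [lintegral_indicator measurableSet_closedBall, ← hball, ofReal_integral_eq_lintegral_ofReal
    ((hg.integrableOn_isCompact (isCompact_closedBall _ _)).const_mul _)
    (.of_forall fun t => mul_nonneg (by positivity) (hg0 t))]

variable {g : ℝ → ℝ} {x M : ℝ}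

theorem summable_geometric_mul_average (hg0 : ∀ t, 0 ≤ g t)
    (hM : ∀ r, 0 < r → ⨍ t in Metric.closedBall x r, g t ≤ M) (hε : 0 < ε) :
    Summable fun k : ℕ => 8 * (1 / 2 : ℝ) ^ k * ⨍ t in Metric.closedBall x (2 ^ k * ε), g t := by
  refine ((summable_geometric_two.mul_left 8).mul_right M).of_nonneg_of_le (fun k => ?_) fun k => ?_
  · exact mul_nonneg (by positivity) (average_nonneg_of_nonneg hg0)
  · gcongr
    exact hM _ (by positivity)

theorem lintegral_mul_poissonKer_le_tsum (hg0 : ∀ t, 0 ≤ g t) (hg : LocallyIntegrable g)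
    (hM : ∀ r, 0 < r → ⨍ t in Metric.closedBall x r, g t ≤ M) (hε : 0 < ε) :
    ∫⁻ t, ENNReal.ofReal (g t * poissonKer ε (x - t)) ≤ ENNReal.ofReal
      (∑' k : ℕ, 8 * (1 / 2) ^ k * ⨍ t in Metric.closedBall x (2 ^ k * ε), g t) := by
  rw [ENNReal.ofReal_tsum_of_nonneg
    (fun k => mul_nonneg (by positivity) (average_nonneg_of_nonneg hg0))
    (summable_geometric_mul_average hg0 hM hε)]
  exact lintegral_mul_poissonKer_le hg0 hg x hε

theorem aestronglyMeasurable_mul_poissonKer (hg : LocallyIntegrable g) (x : ℝ) (hε : 0 < ε) :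
    AEStronglyMeasurable (fun t => g t * poissonKer ε (x - t)) volume :=
  hg.aestronglyMeasurable.mul
    ((continuous_poissonKer hε).comp (continuous_sub_left x)).aestronglyMeasurable

theorem integrable_mul_poissonKer (hg0 : ∀ t, 0 ≤ g t) (hg : LocallyIntegrable g)
    (hM : ∀ r, 0 < r → ⨍ t in Metric.closedBall x r, g t ≤ M) (hε : 0 < ε) :
    Integrable fun t => g t * poissonKer ε (x - t) := by
  refine ⟨aestronglyMeasurable_mul_poissonKer hg x hε, ?_⟩
  rw [hasFiniteIntegral_iff_ofReal
    (.of_forall fun t => mul_nonneg (hg0 t) (poissonKer_pos hε _).le)]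
  exact (lintegral_mul_poissonKer_le_tsum hg0 hg hM hε).trans_lt ENNReal.ofReal_lt_top

theorem tendsto_integral_mul_poissonKer (hg0 : ∀ t, 0 ≤ g t) (hg : LocallyIntegrable g)
    (hM : ∀ r, 0 < r → ⨍ t in Metric.closedBall x r, g t ≤ M)
    (h0 : Tendsto (fun r => ⨍ t in Metric.closedBall x r, g t) (𝓝[>] 0) (𝓝 0)) :
    Tendsto (fun ε => ∫ t, g t * poissonKer ε (x - t)) (𝓝[>] 0) (𝓝 0) := by
  have hterm : ∀ k : ℕ, ∀ r, 0 ≤ 8 * (1 / 2) ^ k * ⨍ t in Metric.closedBall x r, g t :=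
    fun k r => mul_nonneg (by positivity) (average_nonneg_of_nonneg hg0)
  have hscale : ∀ k : ℕ, Tendsto (fun ε : ℝ => 2 ^ k * ε) (𝓝[>] 0) (𝓝[>] 0) := fun k => by
    refine tendsto_nhdsWithin_iff.2 ⟨?_, ?_⟩
    · exact (Continuous.tendsto' (by fun_prop) 0 0 (mul_zero _)).mono_left nhdsWithin_le_nhds
    · filter_upwards [self_mem_nhdsWithin] with ε (hε : 0 < ε)
      exact mul_pos (pow_pos two_pos k) hε
  have hsum : Tendsto
      (fun ε => ∑' k : ℕ, 8 * (1 / 2) ^ k * ⨍ t in Metric.closedBall x (2 ^ k * ε), g t)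
      (𝓝[>] 0) (𝓝 (∑' _ : ℕ, (0 : ℝ))) := by
    refine tendsto_tsum_of_dominated_convergence ((summable_geometric_two.mul_left 8).mul_right M)
      (fun k => by
        simpa only [Function.comp_def, mul_zero] using
          (h0.comp (hscale k)).const_mul (8 * (1 / 2) ^ k)) ?_
    filter_upwards [self_mem_nhdsWithin] with ε (hε : 0 < ε) k
    rw [Real.norm_of_nonneg (hterm k _)]
    exact mul_le_mul_of_nonneg_left (hM _ (by positivity)) (by positivity)
  rw [tsum_zero] at hsum
  have hnonneg : ∀ ε, 0 < ε → ∀ t, 0 ≤ g t * poissonKer ε (x - t) := fun ε hε t =>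
    mul_nonneg (hg0 t) (poissonKer_pos hε _).le
  refine squeeze_zero' ?_ ?_ hsum
  · filter_upwards [self_mem_nhdsWithin] with ε hε using integral_nonneg (hnonneg ε hε)
  · filter_upwards [self_mem_nhdsWithin] with ε hε
    rw [integral_eq_lintegral_of_nonneg_ae (.of_forall (hnonneg ε hε))
      (aestronglyMeasurable_mul_poissonKer hg x hε)]
    exact ENNReal.toReal_le_of_le_ofReal (tsum_nonneg fun k => hterm k _)
      (lintegral_mul_poissonKer_le_tsum hg0 hg hM hε)

end PoissonMeans

section HilbertLimits

variable {a : ℝ → ℂ}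

theorem locallyIntegrable_norm_sub (ha : LocallyIntegrable a) (c : ℂ) :
    LocallyIntegrable fun t => ‖a t - c‖ := fun y => by
  obtain ⟨s, hs, h⟩ := ha.sub (locallyIntegrable_const c) y
  exact ⟨s, hs, h.norm⟩

theorem average_norm_sub_le (ha : MemLp a 2) (c : ℂ) (x : ℝ) {r : ℝ} (hr : 0 < r) :
    ⨍ t in Metric.closedBall x r, ‖a t - c‖ ≤ 1 + ‖c‖ + (∫ t, ‖a t‖ ^ 2) / (2 * r) := by
  have hsq : Integrable fun t => ‖a t‖ ^ 2 := ha.integrable_norm_pow (by norm_num)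
  have hconst : IntegrableOn (fun _ => 1 + ‖c‖) (Metric.closedBall x r) :=
    (locallyIntegrable_const _).integrableOn_isCompact (isCompact_closedBall _ _)
  have hsub : IntegrableOn (fun t => ‖a t - c‖) (Metric.closedBall x r) :=
    (locallyIntegrable_norm_sub (ha.locallyIntegrable one_le_two) c).integrableOn_isCompact
      (isCompact_closedBall _ _)
  have hvol : volume.real (Metric.closedBall x r) = 2 * r := by
    rw [Measure.real, Real.volume_closedBall, ENNReal.toReal_ofReal (by positivity)]
  have hint : ∫ t in Metric.closedBall x r, ‖a t - c‖ ≤ 2 * r * (1 + ‖c‖) + ∫ t, ‖a t‖ ^ 2 :=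
    calc ∫ t in Metric.closedBall x r, ‖a t - c‖
        ≤ ∫ t in Metric.closedBall x r, (1 + ‖c‖ + ‖a t‖ ^ 2) :=
          integral_mono hsub (Integrable.add hconst hsq.integrableOn) fun t => by
            have := norm_sub_le (a t) c
            simp only
            nlinarith [sq_nonneg (‖a t‖ - 1), norm_nonneg (a t)]
      _ = 2 * r * (1 + ‖c‖) + ∫ t in Metric.closedBall x r, ‖a t‖ ^ 2 := by
          rw [integral_add hconst hsq.integrableOn, setIntegral_const, hvol, smul_eq_mul]
      _ ≤ _ := by
          grw [setIntegral_le_integral hsq (.of_forall fun t => sq_nonneg _)]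
  rw [setAverage_eq, hvol, smul_eq_mul]
  calc (2 * r)⁻¹ * ∫ t in Metric.closedBall x r, ‖a t - c‖
      ≤ (2 * r)⁻¹ * (2 * r * (1 + ‖c‖) + ∫ t, ‖a t‖ ^ 2) := by gcongr
    _ = _ := by field_simp

theorem exists_average_norm_sub_le (ha : MemLp a 2) {c : ℂ} {x : ℝ}
    (h0 : Tendsto (fun r => ⨍ t in Metric.closedBall x r, ‖a t - c‖) (𝓝[>] 0) (𝓝 0)) :
    ∃ M, ∀ r, 0 < r → ⨍ t in Metric.closedBall x r, ‖a t - c‖ ≤ M := by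
  obtain ⟨δ, hδ, hsmall⟩ := mem_nhdsGT_iff_exists_Ioo_subset.1 (h0.eventually_le_const zero_lt_one)
  refine ⟨1 + ‖c‖ + (∫ t, ‖a t‖ ^ 2) / (2 * δ), fun r hr => ?_⟩
  have hδ' : (0 : ℝ) < δ := hδ
  rcases lt_or_ge r δ with h | h
  · have : 0 ≤ ‖c‖ + (∫ t, ‖a t‖ ^ 2) / (2 * δ) := by positivity
    exact (hsmall ⟨hr, h⟩ : _ ≤ (1 : ℝ)).trans (by linarith)
  · refine (average_norm_sub_le ha c x hr).trans ?_
    gcongr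

theorem ae_tendsto_integral_norm_sub_mul_poissonKer (ha : MemLp a 2) :
    ∀ᵐ x, (∀ ε, 0 < ε → Integrable fun t => ‖a t - a x‖ * poissonKer ε (x - t)) ∧
      Tendsto (fun ε => ∫ t, ‖a t - a x‖ * poissonKer ε (x - t)) (𝓝[>] 0) (𝓝 0) := by
  have hloc : LocallyIntegrable a := ha.locallyIntegrable one_le_two
  filter_upwards [IsUnifLocDoublingMeasure.ae_tendsto_average_norm_sub volume hloc 1] with x hx
  have h0 : Tendsto (fun r => ⨍ t in Metric.closedBall x r, ‖a t - a x‖) (𝓝[>] 0) (𝓝 0) :=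
    hx (fun _ => x) (fun r => r) tendsto_id <| by
      filter_upwards [self_mem_nhdsWithin] with r (hr : 0 < r)
      exact Metric.mem_closedBall_self (by positivity)
  obtain ⟨M, hM⟩ := exists_average_norm_sub_le ha h0
  have hg := locallyIntegrable_norm_sub hloc (a x)
  exact ⟨fun ε => integrable_mul_poissonKer (fun t => norm_nonneg _) hg hM,
    tendsto_integral_mul_poissonKer (fun t => norm_nonneg _) hg hM h0⟩

theorem ae_tendsto_integral_mul_of_abs_le_poissonKer (ha : MemLp a 2) {k : ℝ → ℝ → ℝ} {m : ℝ}
    (hk : ∀ ε, 0 < ε → Measurable (k ε)) (hle : ∀ ε, 0 < ε → ∀ w, |k ε w| ≤ poissonKer ε w)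
    (hm : ∀ ε, 0 < ε → ∫ w, k ε w = m) :
    ∀ᵐ x, Tendsto (fun ε => ∫ t, a t * (k ε (x - t) : ℂ)) (𝓝[>] 0) (𝓝 (m * a x)) := by
  filter_upwards [ae_tendsto_integral_norm_sub_mul_poissonKer ha] with x ⟨hint, hx⟩
  rw [tendsto_iff_norm_sub_tendsto_zero]
  refine squeeze_zero' (.of_forall fun _ => norm_nonneg _) ?_ hx
  filter_upwards [self_mem_nhdsWithin] with ε (hε : 0 < ε)
  have hk1 : Integrable (k ε) := (integrable_poissonKer hε).mono'
    (hk ε hε).aestronglyMeasurable (.of_forall (hle ε hε))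
  have hconst : ∫ t, a x * (k ε (x - t) : ℂ) = m * a x := by
    rw [integral_const_mul, integral_complex_ofReal, integral_sub_left_eq_self (k ε) volume x,
      hm ε hε, mul_comm]
  have hprod : Integrable fun t => a t * (k ε (x - t) : ℂ) :=
    ha.integrable_mul (memLp_two_of_abs_le_poissonKer (hk ε hε) hε (hle ε hε) x)
  have hsub : Integrable fun t => a x * (k ε (x - t) : ℂ) :=
    (hk1.comp_sub_left x).ofReal.const_mul _
  rw [← hconst, ← integral_sub hprod hsub]
  refine norm_integral_le_of_norm_le (hint ε hε) (.of_forall fun t => ?_)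
  rw [← sub_mul, norm_mul, Complex.norm_real]
  exact mul_le_mul_of_nonneg_left (hle ε hε _) (norm_nonneg _)

theorem ae_tendsto_integral_mul_poissonKer (ha : MemLp a 2) :
    ∀ᵐ x, Tendsto (fun ε => ∫ t, a t * (poissonKer ε (x - t) : ℂ)) (𝓝[>] 0)
      (𝓝 (Real.pi * a x)) :=
  ae_tendsto_integral_mul_of_abs_le_poissonKer ha
    (fun _ hε => (continuous_poissonKer hε).measurable)
    (fun _ hε w => (abs_of_pos (poissonKer_pos hε w)).le) fun _ hε => integral_poissonKer hε

theorem ae_tendsto_integral_mul_conjPoissonKer_sub_truncKer (ha : MemLp a 2) :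
    ∀ᵐ x, Tendsto (fun ε => ∫ t, a t * ((conjPoissonKer ε (x - t) - truncKer ε (x - t) : ℝ) : ℂ))
      (𝓝[>] 0) (𝓝 0) := by
  have hodd : ∀ ε, ∫ w, (conjPoissonKer ε w - truncKer ε w) = 0 := fun ε => by
    have h := integral_neg_eq_self (fun w => conjPoissonKer ε w - truncKer ε w) volume
    simp only [conjPoissonKer_neg, truncKer_neg, ← neg_sub', integral_neg] at h
    linarith
  simpa only [Complex.ofReal_zero, zero_mul] using ae_tendsto_integral_mul_of_abs_le_poissonKer
    ha (k := fun ε w => conjPoissonKer ε w - truncKer ε w)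
    (fun _ hε => (continuous_conjPoissonKer hε).measurable.sub (measurable_truncKer _))
    (fun _ hε => abs_conjPoissonKer_sub_truncKer_le hε) fun ε _ => hodd ε

theorem ae_tendsto_integral_mul_truncKer {b : ℝ → ℂ} (ha : MemLp a 2) (hb : MemLp b 2)
    (h : ∀ ε : ℝ, 0 < ε → ∀ x : ℝ,
      ∫ t, a t * (conjPoissonKer ε (x - t) : ℂ) = ∫ t, b t * (poissonKer ε (x - t) : ℂ)) :
    ∀ᵐ x, Tendsto (fun ε => ∫ t, a t * (truncKer ε (x - t) : ℂ)) (𝓝[>] 0)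
      (𝓝 (Real.pi * b x)) := by
  filter_upwards [ae_tendsto_integral_mul_conjPoissonKer_sub_truncKer ha,
    ae_tendsto_integral_mul_poissonKer hb] with x hsub hpoisson
  have hlim := hpoisson.sub hsub
  rw [sub_zero] at hlim
  refine hlim.congr' ?_
  filter_upwards [self_mem_nhdsWithin] with ε (hε : 0 < ε)
  have hconj : Integrable fun t => a t * (conjPoissonKer ε (x - t) : ℂ) :=
    ha.integrable_mul (memLp_conjPoissonKer hε x)
  have htrunc : Integrable fun t => a t * (truncKer ε (x - t) : ℂ) :=
    ha.integrable_mul (memLp_truncKer hε x)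
  simp only [Complex.ofReal_sub, mul_sub]
  rw [integral_sub hconj htrunc, h ε hε x, sub_sub_cancel]

end HilbertLimits

section HilbertTransform

/-- The two-sided exponential `e^{-2πε|ξ|}`, weighted by `p` on the right and by `q` on the left
half-line; its Fourier transforms include both Poisson kernels. -/
noncomputable def twoSidedExp (p q : ℂ) (ε ξ : ℝ) : ℂ :=
  (if 0 < ξ then p else q) * Real.exp (-(2 * Real.pi * ε) * |ξ|)

variable {ε : ℝ}

theorem norm_twoSidedExp_le (p q : ℂ) (ε ξ : ℝ) :
    ‖twoSidedExp p q ε ξ‖ ≤ (‖p‖ + ‖q‖) * Real.exp (-(2 * Real.pi * ε) * |ξ|) := by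
  rw [twoSidedExp, norm_mul, Complex.norm_real, Real.norm_of_nonneg (Real.exp_pos _).le]
  gcongr
  split_ifs
  · exact le_add_of_nonneg_right (norm_nonneg q)
  · exact le_add_of_nonneg_left (norm_nonneg p)

theorem measurable_twoSidedExp (p q : ℂ) (ε : ℝ) : Measurable (twoSidedExp p q ε) :=
  (Measurable.ite measurableSet_Ioi measurable_const measurable_const).mul
    (Continuous.measurable (by fun_prop))

theorem integrable_exp_neg_mul_abs {c : ℝ} (hc : 0 < c) :
    Integrable fun ξ : ℝ => Real.exp (-c * |ξ|) := by
  have hright : IntegrableOn (fun ξ : ℝ => Real.exp (-c * |ξ|)) (Ioi 0) :=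
    (integrableOn_exp_mul_Ioi (neg_lt_zero.2 hc) 0).congr_fun
      (fun ξ (hξ : 0 < ξ) => by simp only [abs_of_pos hξ]) measurableSet_Ioi
  have hleft : IntegrableOn (fun ξ : ℝ => Real.exp (-c * |ξ|)) (Iic 0) :=
    (integrableOn_exp_mul_Iic hc 0).congr_fun
      (fun ξ (hξ : ξ ≤ 0) => by simp only [abs_of_nonpos hξ, neg_mul_neg]) measurableSet_Iic
  rw [← integrableOn_univ, ← Iic_union_Ioi (a := (0 : ℝ))]
  exact hleft.union hright

theorem integrable_twoSidedExp (p q : ℂ) (hε : 0 < ε) : Integrable (twoSidedExp p q ε) :=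
  ((integrable_exp_neg_mul_abs (c := 2 * Real.pi * ε) (by positivity)).const_mul _).mono'
    (measurable_twoSidedExp p q ε).aestronglyMeasurable (.of_forall (norm_twoSidedExp_le p q ε))

theorem memLp_two_of_integrable_of_norm_le {f : ℝ → ℂ} {C : ℝ} (hf : Integrable f)
    (hC : ∀ x, ‖f x‖ ≤ C) : MemLp f 2 := by
  rw [memLp_two_iff_integrable_sq_norm hf.aestronglyMeasurable]
  refine (hf.norm.const_mul C).mono' (hf.norm.aestronglyMeasurable.pow 2) (.of_forall fun x => ?_)
  rw [norm_pow, norm_norm, sq]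
  exact mul_le_mul_of_nonneg_right (hC x) (norm_nonneg _)

theorem memLp_twoSidedExp (p q : ℂ) (hε : 0 < ε) : MemLp (twoSidedExp p q ε) 2 := by
  refine memLp_two_of_integrable_of_norm_le (integrable_twoSidedExp p q hε) fun ξ =>
    (norm_twoSidedExp_le p q ε ξ).trans (mul_le_of_le_one_right (by positivity) ?_)
  have : 0 ≤ 2 * Real.pi * ε * |ξ| := by positivity
  exact Real.exp_le_one_iff.2 (by linarith)

theorem exp_smul_twoSidedExp_of_pos (p q : ℂ) (u : ℝ) {ξ : ℝ} (hξ : 0 < ξ) :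
    Complex.exp (↑(-2 * Real.pi * ξ * u) * Complex.I) • twoSidedExp p q ε ξ =
      p * Complex.exp (-(2 * Real.pi * (ε + u * Complex.I)) * ξ) := by
  rw [twoSidedExp, if_pos hξ, abs_of_pos hξ, smul_eq_mul, mul_left_comm, Complex.ofReal_exp,
    ← Complex.exp_add]
  push_cast
  ring_nf

theorem exp_smul_twoSidedExp_of_nonpos (p q : ℂ) (u : ℝ) {ξ : ℝ} (hξ : ξ ≤ 0) :
    Complex.exp (↑(-2 * Real.pi * ξ * u) * Complex.I) • twoSidedExp p q ε ξ =
      q * Complex.exp (2 * Real.pi * (ε - u * Complex.I) * ξ) := by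
  rw [twoSidedExp, if_neg hξ.not_gt, abs_of_nonpos hξ, smul_eq_mul, mul_left_comm,
    Complex.ofReal_exp, ← Complex.exp_add]
  push_cast
  ring_nf

theorem fourier_twoSidedExp (p q : ℂ) (hε : 0 < ε) (u : ℝ) :
    𝓕 (twoSidedExp p q ε) u =
      p / (2 * Real.pi * (ε + u * Complex.I)) + q / (2 * Real.pi * (ε - u * Complex.I)) := by
  have hpos : 0 < 2 * Real.pi * ε := by positivity
  have hright : (-(2 * Real.pi * (ε + u * Complex.I)) : ℂ).re < 0 := by simpa using hpos
  have hleft : 0 < (2 * Real.pi * (ε - u * Complex.I) : ℂ).re := by simpa using hpos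
  have hIoi : EqOn (fun ξ : ℝ => Complex.exp (↑(-2 * Real.pi * ξ * u) * Complex.I) •
      twoSidedExp p q ε ξ) _ (Ioi 0) := fun ξ hξ => exp_smul_twoSidedExp_of_pos p q u hξ
  have hIic : EqOn (fun ξ : ℝ => Complex.exp (↑(-2 * Real.pi * ξ * u) * Complex.I) •
      twoSidedExp p q ε ξ) _ (Iic 0) := fun ξ hξ => exp_smul_twoSidedExp_of_nonpos p q u hξ
  rw [Real.fourier_real_eq_integral_exp_smul, ← intervalIntegral.integral_Iic_add_Ioi (b := 0)
    (IntegrableOn.congr_fun ((integrableOn_exp_mul_complex_Iic hleft 0).const_mul q) hIic.symm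
      measurableSet_Iic)
    (IntegrableOn.congr_fun ((integrableOn_exp_mul_complex_Ioi hright 0).const_mul p) hIoi.symm
      measurableSet_Ioi),
    setIntegral_congr_fun measurableSet_Ioi hIoi, setIntegral_congr_fun measurableSet_Iic hIic,
    integral_const_mul, integral_const_mul, integral_exp_mul_complex_Ioi hright,
    integral_exp_mul_complex_Iic hleft, Complex.ofReal_zero, mul_zero, mul_zero, Complex.exp_zero,
    neg_div_neg_eq, mul_one_div, mul_one_div, add_comm]

theorem add_mul_I_mul_sub_mul_I (ε u : ℝ) :
    (ε + u * Complex.I) * (ε - u * Complex.I) = ((u ^ 2 + ε ^ 2 : ℝ) : ℂ) := by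
  push_cast
  linear_combination (-(u : ℂ) ^ 2) * Complex.I_sq

theorem fourier_twoSidedExp_eq_poissonKer (p q : ℂ) (hε : 0 < ε) (u : ℝ) :
    𝓕 (twoSidedExp p q ε) u = ((p + q) / 2 * poissonKer ε u -
      Complex.I * (p - q) / 2 * conjPoissonKer ε u) / Real.pi := by
  have hne : (((u ^ 2 + ε ^ 2 : ℝ)) : ℂ) ≠ 0 := by
    exact_mod_cast (by positivity : u ^ 2 + ε ^ 2 ≠ 0)
  have hmul := add_mul_I_mul_sub_mul_I ε u
  have hplus : (ε + u * Complex.I : ℂ) ≠ 0 := left_ne_zero_of_mul (hmul ▸ hne)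
  have hminus : (ε - u * Complex.I : ℂ) ≠ 0 := right_ne_zero_of_mul (hmul ▸ hne)
  have hπ : (Real.pi : ℂ) ≠ 0 := Complex.ofReal_ne_zero.2 Real.pi_ne_zero
  rw [fourier_twoSidedExp p q hε, poissonKer, conjPoissonKer, Complex.ofReal_div,
    Complex.ofReal_div, ← hmul]
  field_simp
  ring

theorem poissonKer_sub_comm (ε t x : ℝ) : poissonKer ε (t - x) = poissonKer ε (x - t) := by
  rw [poissonKer, poissonKer, sub_sq_comm]

theorem integral_mul_poissonKer_eq (a : ℝ →₂[volume] ℂ) (hε : 0 < ε) (x : ℝ) :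
    ∫ t, a t * (poissonKer ε (x - t) : ℂ) = Real.pi *
      𝓕⁻ (fun ξ => (𝓕 a : ℝ →₂[volume] ℂ) ξ * twoSidedExp 1 1 ε ξ) x := by
  rw [← integral_mul_fourier_sub_eq a (integrable_twoSidedExp 1 1 hε) (memLp_twoSidedExp 1 1 hε),
    ← integral_const_mul]
  congr 1 with t
  have hπ : (Real.pi : ℂ) ≠ 0 := Complex.ofReal_ne_zero.2 Real.pi_ne_zero
  rw [fourier_twoSidedExp_eq_poissonKer _ _ hε, poissonKer_sub_comm]
  field_simp
  ring

theorem integral_mul_conjPoissonKer_eq (a : ℝ →₂[volume] ℂ) (hε : 0 < ε) (x : ℝ) :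
    ∫ t, a t * (conjPoissonKer ε (x - t) : ℂ) = Real.pi *
      𝓕⁻ (fun ξ => (𝓕 a : ℝ →₂[volume] ℂ) ξ * twoSidedExp (-Complex.I) Complex.I ε ξ) x := by
  rw [← integral_mul_fourier_sub_eq a (integrable_twoSidedExp _ _ hε) (memLp_twoSidedExp _ _ hε),
    ← integral_const_mul]
  congr 1 with t
  have hπ : (Real.pi : ℂ) ≠ 0 := Complex.ofReal_ne_zero.2 Real.pi_ne_zero
  rw [fourier_twoSidedExp_eq_poissonKer _ _ hε, ← neg_sub x t, conjPoissonKer_neg,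
    Complex.ofReal_neg]
  field_simp
  linear_combination (2 * a t * (conjPoissonKer ε (x - t) : ℂ)) * Complex.I_sq

/-- The Fourier multiplier `-i sgn ξ` of the Hilbert transform. -/
noncomputable def hilbertMultiplier (ξ : ℝ) : ℂ := if 0 < ξ then -Complex.I else Complex.I

theorem norm_hilbertMultiplier (ξ : ℝ) : ‖hilbertMultiplier ξ‖ = 1 := by
  rw [hilbertMultiplier]
  split_ifs <;> simp

theorem memLp_hilbertMultiplier_mul (b : ℝ →₂[volume] ℂ) :
    MemLp (fun ξ => hilbertMultiplier ξ * b ξ) 2 := by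
  have hm : Measurable hilbertMultiplier :=
    Measurable.ite measurableSet_Ioi measurable_const measurable_const
  refine (Lp.memLp b).of_le (hm.aestronglyMeasurable.mul (Lp.aestronglyMeasurable b))
    (.of_forall fun ξ => ?_)
  rw [norm_mul, norm_hilbertMultiplier, one_mul]

/-- The Hilbert transform on `L²(ℝ)`, normalized to be an isometry and defined through its Fourier
multiplier. -/
noncomputable def hilbertL2 (a : ℝ →₂[volume] ℂ) : ℝ →₂[volume] ℂ :=
  𝓕⁻ ((memLp_hilbertMultiplier_mul (𝓕 a)).toLp _)

theorem fourier_hilbertL2_ae_eq (a : ℝ →₂[volume] ℂ) :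
    (𝓕 (hilbertL2 a) : ℝ →₂[volume] ℂ) =ᵐ[volume]
      fun ξ => hilbertMultiplier ξ * (𝓕 a : ℝ →₂[volume] ℂ) ξ := by
  rw [hilbertL2, FourierTransform.fourier_fourierInv_eq]
  exact MemLp.coeFn_toLp _

theorem fourierInv_congr_ae {F G : ℝ → ℂ} (h : F =ᵐ[volume] G) (x : ℝ) : 𝓕⁻ F x = 𝓕⁻ G x := by
  rw [Real.fourierInv_eq, Real.fourierInv_eq]
  exact integral_congr_ae (h.mono fun ξ hξ => by simp only [hξ])

theorem integral_mul_conjPoissonKer_eq_hilbertL2 (a : ℝ →₂[volume] ℂ) (hε : 0 < ε) (x : ℝ) :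
    ∫ t, a t * (conjPoissonKer ε (x - t) : ℂ) =
      ∫ t, hilbertL2 a t * (poissonKer ε (x - t) : ℂ) := by
  rw [integral_mul_conjPoissonKer_eq a hε, integral_mul_poissonKer_eq _ hε]
  congr 1
  refine fourierInv_congr_ae ?_ x
  filter_upwards [fourier_hilbertL2_ae_eq a] with ξ hξ
  rw [hξ, hilbertMultiplier, twoSidedExp, twoSidedExp]
  split_ifs <;> ring

theorem integral_hilbertL2_mul_conjPoissonKer_eq (a : ℝ →₂[volume] ℂ) (hε : 0 < ε) (x : ℝ) :
    ∫ t, hilbertL2 a t * (conjPoissonKer ε (x - t) : ℂ) =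
      -∫ t, a t * (poissonKer ε (x - t) : ℂ) := by
  have hmul : (fun ξ => (𝓕 (hilbertL2 a) : ℝ →₂[volume] ℂ) ξ *
      twoSidedExp (-Complex.I) Complex.I ε ξ) =ᵐ[volume]
      fun ξ => -((𝓕 a : ℝ →₂[volume] ℂ) ξ * twoSidedExp 1 1 ε ξ) := by
    filter_upwards [fourier_hilbertL2_ae_eq a] with ξ hξ
    rw [hξ, hilbertMultiplier, twoSidedExp, twoSidedExp, ite_self]
    split_ifs <;> linear_combination ((𝓕 a : ℝ →₂[volume] ℂ) ξ *
      (Real.exp (-(2 * Real.pi * ε) * |ξ|) : ℂ)) * Complex.I_sq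
  rw [integral_mul_conjPoissonKer_eq _ hε, integral_mul_poissonKer_eq a hε, ← mul_neg,
    fourierInv_congr_ae hmul, Real.fourierInv_eq, Real.fourierInv_eq, ← integral_neg]
  simp only [smul_neg]

theorem ae_tendsto_integral_mul_truncKer_hilbertL2 (a : ℝ →₂[volume] ℂ) :
    ∀ᵐ x, Tendsto (fun ε => ∫ t, a t * (truncKer ε (x - t) : ℂ)) (𝓝[>] 0)
      (𝓝 (Real.pi * hilbertL2 a x)) :=
  ae_tendsto_integral_mul_truncKer (Lp.memLp a) (Lp.memLp _)
    fun _ hε x => integral_mul_conjPoissonKer_eq_hilbertL2 a hε x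

theorem ae_comp_neg {p : ℝ → Prop} (h : ∀ᵐ x, p x) : ∀ᵐ x, p (-x) :=
  (Measure.measurePreserving_neg (volume : Measure ℝ)).quasiMeasurePreserving.ae h

theorem hilbertL2_neg_ae_eq {a : ℝ →₂[volume] ℂ} {c : ℂ} (ha : ∀ᵐ t, a (-t) = c * a t) :
    ∀ᵐ x, hilbertL2 a (-x) = -c * hilbertL2 a x := by
  have hlim := ae_tendsto_integral_mul_truncKer_hilbertL2 a
  filter_upwards [hlim, ae_comp_neg hlim] with x hx hx'
  have hneg : Tendsto (fun ε => ∫ t, a t * (truncKer ε (-x - t) : ℂ)) (𝓝[>] 0)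
      (𝓝 (-c * (Real.pi * hilbertL2 a x))) := by
    refine (hx.const_mul (-c)).congr fun ε => ?_
    rw [← integral_const_mul, ← integral_neg_eq_self
      (fun t => a t * (truncKer ε (-x - t) : ℂ))]
    refine integral_congr_ae (ha.mono fun t ht => ?_)
    simp only [ht, show -x - -t = -(x - t) by ring, truncKer_neg, Complex.ofReal_neg]
    ring
  refine mul_left_cancel₀ (Complex.ofReal_ne_zero.2 Real.pi_ne_zero) ?_
  rw [tendsto_nhds_unique hx' hneg]
  ring

end HilbertTransform

section CriticalLineKernel

theorem ofReal_exp_cpow (r : ℝ) (z : ℂ) : (Real.exp r : ℂ) ^ z = Complex.exp (r * z) := by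
  rw [Complex.cpow_def_of_ne_zero (Complex.ofReal_ne_zero.2 (Real.exp_pos r).ne'),
    ← Complex.ofReal_log (Real.exp_pos r).le, Real.log_exp]

theorem betaIntegral_one_sub {p : ℂ} (h0 : 0 < p.re) (h1 : p.re < 1) :
    Complex.betaIntegral p (1 - p) = Real.pi / Complex.sin (Real.pi * p) := by
  have h := Complex.Gamma_mul_Gamma_eq_betaIntegral (s := p) (t := 1 - p) h0 (by simpa using h1)
  rwa [add_sub_cancel, Complex.Gamma_one, one_mul, Complex.Gamma_mul_Gamma_one_sub, eq_comm] at h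

theorem abs_deriv_sigmoid_smul_betaIntegrand (p : ℂ) (w : ℝ) :
    |Real.sigmoid w * (1 - Real.sigmoid w)| • ((Real.sigmoid w : ℂ) ^ (p - 1) *
      (1 - (Real.sigmoid w : ℂ)) ^ (1 - p - 1)) =
      Complex.exp (w * (p - 1)) * (Real.sigmoid w : ℂ) := by
  have hσ : (Real.sigmoid w : ℂ) ≠ 0 := Complex.ofReal_ne_zero.2 (Real.sigmoid_pos w).ne'
  have hpos : 0 < 1 - Real.sigmoid w := sub_pos.2 (Real.sigmoid_lt_one w)
  have hσ' : (1 : ℂ) - Real.sigmoid w ≠ 0 := by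
    rw [← Complex.ofReal_one, ← Complex.ofReal_sub]
    exact Complex.ofReal_ne_zero.2 hpos.ne'
  have hsub : (1 : ℂ) - Real.sigmoid w = (Real.sigmoid w : ℂ) * (Real.exp (-w) : ℂ) := by
    rw [← Complex.ofReal_mul, Real.sigmoid_mul_rexp_neg, Real.sigmoid_neg, Complex.ofReal_sub,
      Complex.ofReal_one]
  calc _ = (Real.sigmoid w : ℂ) ^ p * (1 - (Real.sigmoid w : ℂ)) ^ (1 - p) := by
        rw [abs_of_pos (mul_pos (Real.sigmoid_pos w) hpos), Complex.real_smul,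
          Complex.cpow_sub _ _ hσ, Complex.cpow_sub _ _ hσ', Complex.cpow_one, Complex.cpow_one,
          Complex.ofReal_mul, Complex.ofReal_sub, Complex.ofReal_one]
        field_simp
    _ = (Real.sigmoid w : ℂ) ^ p * (Real.sigmoid w : ℂ) ^ (1 - p) *
          (Real.exp (-w) : ℂ) ^ (1 - p) := by
        rw [hsub, Complex.mul_cpow_ofReal_nonneg (Real.sigmoid_pos w).le (Real.exp_pos _).le,
          mul_assoc]
    _ = _ := by
        rw [← Complex.cpow_add _ _ hσ, add_sub_cancel, Complex.cpow_one, ofReal_exp_cpow, mul_comm]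
        congr 2
        push_cast
        ring

theorem integral_exp_mul_sigmoid {p : ℂ} (h0 : 0 < p.re) (h1 : p.re < 1) :
    ∫ w : ℝ, Complex.exp (w * (p - 1)) * (Real.sigmoid w : ℂ) =
      Real.pi / Complex.sin (Real.pi * p) := by
  rw [← betaIntegral_one_sub h0 h1, Complex.betaIntegral,
    intervalIntegral.integral_of_le zero_le_one, integral_Ioc_eq_integral_Ioo,
    ← Real.range_sigmoid, ← image_univ, integral_image_eq_integral_abs_deriv_smul MeasurableSet.univ
      (fun w _ => (Real.hasDerivAt_sigmoid w).hasDerivWithinAt) Real.sigmoid_injective.injOn,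
    setIntegral_univ]
  simp only [abs_deriv_sigmoid_smul_betaIntegrand]

/-- `cos (π s / 2)` on the critical line, at `s = 1/2 + 2πiξ`, so that `ξ` is the frequency of
`u ↦ exp (-2πiξu)`. -/
noncomputable def critCos (ξ : ℝ) : ℂ :=
  Complex.cos ((Real.pi : ℂ) * critPt (2 * Real.pi * ξ) / 2)

theorem critPt_neg (τ : ℝ) : critPt (-τ) = 1 - critPt τ := by
  rw [critPt, critPt, Complex.ofReal_neg]
  ring

theorem critCos_neg (ξ : ℝ) :
    critCos (-ξ) = Complex.sin ((Real.pi : ℂ) * critPt (2 * Real.pi * ξ) / 2) := by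
  rw [critCos, mul_neg, critPt_neg, ← Complex.cos_pi_div_two_sub]
  congr 1
  ring

theorem continuous_critCos : Continuous critCos := by
  unfold critCos critPt
  fun_prop

theorem re_critCos (ξ : ℝ) : (critCos ξ).re = √2 / 2 * Real.cosh (Real.pi ^ 2 * ξ) := by
  have harg : (Real.pi : ℂ) * critPt (2 * Real.pi * ξ) / 2 =
      ((Real.pi / 4 : ℝ) : ℂ) + ((Real.pi ^ 2 * ξ : ℝ) : ℂ) * Complex.I := by
    rw [critPt]
    push_cast
    ring
  rw [critCos, harg, Complex.cos_add_mul_I, ← Complex.ofReal_cos, ← Complex.ofReal_cosh,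
    ← Complex.ofReal_sin, ← Complex.ofReal_sinh, Real.cos_pi_div_four, ← Complex.ofReal_mul,
    ← Complex.ofReal_mul, Complex.sub_re, Complex.ofReal_re, Complex.re_ofReal_mul, Complex.I_re,
    mul_zero, sub_zero]

theorem one_add_sq_div_four_le_cosh (y : ℝ) : 1 + y ^ 2 / 4 ≤ Real.cosh y := by
  rw [← Real.cosh_abs, Real.cosh_eq, ← sq_abs]
  have h1 := Real.quadratic_le_exp_of_nonneg (abs_nonneg y)
  have h2 := Real.add_one_le_exp (-|y|)
  linarith

theorem one_add_sq_le_norm_critCos (ξ : ℝ) : (1 + ξ ^ 2) / 4 ≤ ‖critCos ξ‖ := by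
  refine le_trans ?_ ((re_critCos ξ).ge.trans (Complex.re_le_norm _))
  have hcosh : (1 + ξ ^ 2) / 2 ≤ Real.cosh (Real.pi ^ 2 * ξ) := by
    have hπ : 2 ≤ (Real.pi ^ 2) ^ 2 := by nlinarith [Real.pi_gt_three, sq_nonneg (Real.pi ^ 2 - 1)]
    nlinarith [one_add_sq_div_four_le_cosh (Real.pi ^ 2 * ξ),
      mul_le_mul_of_nonneg_right hπ (sq_nonneg ξ)]
  have hsqrt : (1 : ℝ) ≤ √2 := Real.one_le_sqrt.2 (by norm_num)
  nlinarith [Real.cosh_pos (Real.pi ^ 2 * ξ)]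

theorem critCos_ne_zero (ξ : ℝ) : critCos ξ ≠ 0 :=
  norm_pos_iff.1 (lt_of_lt_of_le (by positivity) (one_add_sq_le_norm_critCos ξ))

theorem norm_inv_critCos_le (ξ : ℝ) : ‖(critCos ξ)⁻¹‖ ≤ 4 * (1 + ξ ^ 2)⁻¹ := by
  rw [norm_inv, inv_le_comm₀ (norm_pos_iff.2 (critCos_ne_zero ξ)) (by positivity), mul_inv, inv_inv,
    mul_comm, ← div_eq_mul_inv]
  exact one_add_sq_le_norm_critCos ξ

theorem integrable_inv_critCos : Integrable fun ξ => (critCos ξ)⁻¹ :=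
  (integrable_inv_one_add_sq.const_mul 4).mono'
    (continuous_critCos.inv₀ critCos_ne_zero).aestronglyMeasurable (.of_forall norm_inv_critCos_le)

theorem memLp_inv_critCos : MemLp (fun ξ => (critCos ξ)⁻¹) 2 :=
  memLp_two_of_integrable_of_norm_le (C := 4) integrable_inv_critCos fun ξ =>
    (norm_inv_critCos_le ξ).trans (mul_le_of_le_one_right (by norm_num)
      (inv_le_one_of_one_le₀ (le_add_of_nonneg_right (sq_nonneg ξ))))

/-- The kernel `t / (1 + t²)` in the logarithmic variable `t = e^{-w}`, with the factor
`e^{-w/2}` of the critical line. -/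
noncomputable def logKer (w : ℝ) : ℝ := Real.exp (-w / 2) / (Real.exp w + Real.exp (-w))

theorem continuous_logKer : Continuous logKer :=
  Continuous.div (by fun_prop) (by fun_prop) fun w => by positivity

theorem integrable_logKer : Integrable logKer := by
  refine (integrable_exp_neg_mul_abs (c := 1 / 2) (by norm_num)).mono'
    continuous_logKer.aestronglyMeasurable (.of_forall fun w => ?_)
  rw [logKer, Real.norm_of_nonneg (by positivity), div_le_iff₀ (by positivity), mul_add,
    ← Real.exp_add, ← Real.exp_add]
  rcases le_total 0 w with hw | hw
  · have h : Real.exp (-w / 2) ≤ Real.exp (-(1 / 2) * |w| + w) :=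
      Real.exp_le_exp.2 (by rw [abs_of_nonneg hw]; linarith)
    linarith [Real.exp_pos (-(1 / 2) * |w| + -w)]
  · have h : Real.exp (-w / 2) ≤ Real.exp (-(1 / 2) * |w| + -w) :=
      Real.exp_le_exp.2 (by rw [abs_of_nonpos hw]; linarith)
    linarith [Real.exp_pos (-(1 / 2) * |w| + w)]

theorem logKer_eq_exp_mul_sigmoid (w : ℝ) :
    logKer w = Real.exp (-(3 / 2 * w)) * Real.sigmoid (2 * w) := by
  rw [logKer, Real.sigmoid_def, ← div_eq_mul_inv, div_eq_div_iff (by positivity) (by positivity),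
    mul_add, mul_add, mul_one, ← Real.exp_add, ← Real.exp_add, ← Real.exp_add]
  ring_nf

theorem fourier_logKer (ξ : ℝ) :
    𝓕 (fun w => (logKer w : ℂ)) ξ = Real.pi / 2 * (critCos ξ)⁻¹ := by
  set p : ℂ := ((1 / 4 : ℝ) : ℂ) + ((-(Real.pi * ξ) : ℝ) : ℂ) * Complex.I with hp
  have hre : p.re = 1 / 4 := by
    rw [hp, Complex.add_re, Complex.ofReal_re, Complex.re_ofReal_mul, Complex.I_re, mul_zero,
      add_zero]
  have hsin : Complex.sin (Real.pi * p) = critCos ξ := by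
    rw [critCos, ← Complex.sin_pi_div_two_sub, hp, critPt]
    congr 1
    push_cast
    ring
  calc 𝓕 (fun w => (logKer w : ℂ)) ξ
      = ∫ w : ℝ, Complex.exp ((2 * w : ℝ) * (p - 1)) * (Real.sigmoid (2 * w) : ℂ) := by
        rw [Real.fourier_real_eq_integral_exp_smul]
        congr 1 with w
        rw [logKer_eq_exp_mul_sigmoid, Complex.ofReal_mul (Real.exp _), smul_eq_mul,
          Complex.ofReal_exp, ← mul_assoc, ← Complex.exp_add, hp]
        congr 2
        push_cast
        ring
    _ = _ := by
        rw [Measure.integral_comp_mul_left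
            (fun w : ℝ => Complex.exp (w * (p - 1)) * (Real.sigmoid w : ℂ)) 2,
          integral_exp_mul_sigmoid (by rw [hre]; norm_num) (by rw [hre]; norm_num), hsin,
          abs_of_pos (by norm_num), Complex.real_smul]
        push_cast
        ring

theorem fourierInv_inv_critCos (w : ℝ) :
    𝓕⁻ (fun ξ => (Real.pi / 2 : ℂ) * (critCos ξ)⁻¹) w = logKer w := by
  have hF : 𝓕 (fun w => (logKer w : ℂ)) = fun ξ => (Real.pi / 2 : ℂ) * (critCos ξ)⁻¹ :=
    funext fourier_logKer
  have hc : Continuous fun w => (logKer w : ℂ) := Complex.continuous_ofReal.comp continuous_logKer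
  have hi := integrable_inv_critCos.const_mul (Real.pi / 2 : ℂ)
  rw [← hF] at hi ⊢
  rw [hc.fourierInv_fourier_eq integrable_logKer.ofReal hi]

theorem fourier_inv_critCos (w : ℝ) :
    𝓕 (fun ξ => (Real.pi / 2 : ℂ) * (critCos ξ)⁻¹) w = logKer (-w) := by
  rw [← fourierInv_inv_critCos, Real.fourierInv_eq_fourier_neg, neg_neg]

theorem fourier_inv_critCos_neg (w : ℝ) :
    𝓕 (fun ξ => (Real.pi / 2 : ℂ) * (critCos (-ξ))⁻¹) w = logKer w := by
  rw [← fourierInv_inv_critCos, Real.fourierInv_eq_fourier_comp_neg]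

theorem fourier_mul_critCos_ae_eq {a b : ℝ →₂[volume] ℂ}
    (h : ∀ v, ∫ u, a u * (logKer (u - v) : ℂ) = ∫ u, b u * (logKer (v - u) : ℂ)) :
    ∀ᵐ ξ, (𝓕 a : ℝ →₂[volume] ℂ) ξ * critCos ξ = (𝓕 b : ℝ →₂[volume] ℂ) ξ * critCos (-ξ) := by
  have hK₂ := integrable_inv_critCos.const_mul (Real.pi / 2 : ℂ)
  have hK₂' := memLp_inv_critCos.const_mul (Real.pi / 2 : ℂ)
  have hmul := fourier_mul_ae_eq_of_integral_eq (a := a) (b := b) hK₂.comp_neg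
    (hK₂'.comp_measurePreserving (Measure.measurePreserving_neg volume)) hK₂ hK₂' fun v => by
      simpa only [fourier_inv_critCos, fourier_inv_critCos_neg, neg_sub] using h v
  filter_upwards [hmul] with ξ hξ
  have h1 := critCos_ne_zero ξ
  have h2 := critCos_ne_zero (-ξ)
  have hπ : (Real.pi : ℂ) ≠ 0 := Complex.ofReal_ne_zero.2 Real.pi_ne_zero
  field_simp at hξ
  rw [hξ, mul_comm]

end CriticalLineKernel

section LogarithmicVariable

theorem hasDerivAt_exp_neg (u : ℝ) :
    HasDerivAt (fun u : ℝ => Real.exp (-u)) (-Real.exp (-u)) u := by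
  simpa only [mul_neg_one] using (hasDerivAt_neg u).exp

theorem image_exp_neg_univ : (fun u : ℝ => Real.exp (-u)) '' univ = Ioi 0 := by
  rw [image_univ, ← Real.range_exp]
  exact neg_surjective.range_comp Real.exp

theorem exp_neg_injective : Function.Injective fun u : ℝ => Real.exp (-u) :=
  Real.exp_injective.comp neg_injective

theorem lintegral_Ioi_eq_lintegral_exp_neg (g : ℝ → ℝ≥0∞) :
    ∫⁻ t in Ioi 0, g t = ∫⁻ u, ENNReal.ofReal (Real.exp (-u)) * g (Real.exp (-u)) := by
  rw [← image_exp_neg_univ, lintegral_image_eq_lintegral_abs_deriv_mul MeasurableSet.univ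
    (fun u _ => (hasDerivAt_exp_neg u).hasDerivWithinAt) exp_neg_injective.injOn, setLIntegral_univ]
  simp only [abs_neg, Real.abs_exp]

theorem integral_Ioi_eq_integral_exp_neg {E : Type*} [NormedAddCommGroup E] [NormedSpace ℝ E]
    (g : ℝ → E) : ∫ t in Ioi 0, g t = ∫ u, Real.exp (-u) • g (Real.exp (-u)) := by
  rw [← image_exp_neg_univ, integral_image_eq_integral_abs_deriv_smul MeasurableSet.univ
    (fun u _ => (hasDerivAt_exp_neg u).hasDerivWithinAt) exp_neg_injective.injOn, setIntegral_univ]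
  simp only [abs_neg, Real.abs_exp]

theorem map_exp_neg_withDensity :
    (volume.withDensity fun u => ENNReal.ofReal (Real.exp (-u))).map (fun u => Real.exp (-u)) =
      volume.restrict (Ioi 0) := by
  refine Measure.ext_of_lintegral _ fun g hg => ?_
  rw [lintegral_map hg (by fun_prop),
    lintegral_withDensity_eq_lintegral_mul _ (by fun_prop) (by fun_prop),
    lintegral_Ioi_eq_lintegral_exp_neg]
  rfl

theorem ae_Ioi_iff_ae_exp_neg {P : ℝ → Prop} :
    (∀ᵐ x ∂volume.restrict (Ioi (0 : ℝ)), P x) ↔ ∀ᵐ u : ℝ, P (Real.exp (-u)) := by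
  have hemb : MeasurableEmbedding fun u : ℝ => Real.exp (-u) :=
    Continuous.measurableEmbedding (by fun_prop) exp_neg_injective
  rw [← map_exp_neg_withDensity, hemb.ae_map_iff, ae_withDensity_iff (by fun_prop)]
  simp only [ne_eq, ENNReal.ofReal_eq_zero, (Real.exp_pos _).not_ge, not_false_eq_true,
    forall_const]

theorem quasiMeasurePreserving_exp_neg :
    Measure.QuasiMeasurePreserving (fun u : ℝ => Real.exp (-u)) volume
      (volume.restrict (Ioi 0)) := by
  refine ⟨by fun_prop, ?_⟩
  rw [← map_exp_neg_withDensity]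
  exact (withDensity_absolutelyContinuous' (by fun_prop)
    (.of_forall fun u => (ENNReal.ofReal_pos.2 (Real.exp_pos _)).ne')).map (by fun_prop)

theorem ae_Ioi_one_div_iff {P : ℝ → Prop} :
    (∀ᵐ x ∂volume.restrict (Ioi (0 : ℝ)), P (1 / x)) ↔
      ∀ᵐ x ∂volume.restrict (Ioi (0 : ℝ)), P x := by
  simp only [ae_Ioi_iff_ae_exp_neg, one_div, ← Real.exp_neg]
  refine ⟨fun h => ?_, fun h => ae_comp_neg h⟩
  simpa only [neg_neg] using ae_comp_neg h

/-- The function `f` in the logarithmic variable `t = e^{-u}`, normalized so as to preserve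
the `L²` norm. -/
noncomputable def logPull (f : ℝ → ℂ) (u : ℝ) : ℂ := (Real.exp (-u / 2) : ℂ) * f (Real.exp (-u))

theorem eLpNorm_logPull (f : ℝ → ℂ) :
    eLpNorm (logPull f) 2 volume = eLpNorm f 2 (volume.restrict (Ioi 0)) := by
  rw [eLpNorm_eq_lintegral_rpow_enorm_toReal (by norm_num) (by norm_num),
    eLpNorm_eq_lintegral_rpow_enorm_toReal (by norm_num) (by norm_num),
    lintegral_Ioi_eq_lintegral_exp_neg]
  congr 2 with u
  rw [logPull, enorm_mul, ENNReal.mul_rpow_of_nonneg _ _ (by norm_num), ← ofReal_norm,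
    Complex.norm_real, Real.norm_of_nonneg (Real.exp_pos _).le,
    ENNReal.ofReal_rpow_of_pos (Real.exp_pos _), ← Real.exp_mul, ENNReal.toReal_ofNat,
    div_mul_cancel₀ _ two_ne_zero]

theorem memLp_logPull {f : ℝ → ℂ} (hf : MemL2HalfLine f) : MemLp (logPull f) 2 :=
  ⟨(Continuous.aestronglyMeasurable (by fun_prop)).mul
    (hf.1.comp_quasiMeasurePreserving quasiMeasurePreserving_exp_neg),
    (eLpNorm_logPull f).trans_lt hf.2⟩

end LogarithmicVariable

section Dilation

variable {c : ℝ} {E : Type*} [NormedAddCommGroup E]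

theorem eLpNorm_comp_mul_left (hc : c ≠ 0) (p : ℝ → E) {q : ℝ≥0∞} (hq : q ≠ ∞) :
    eLpNorm (fun x => p (c * x)) q volume =
      ENNReal.ofReal |c⁻¹| ^ (1 / q).toReal * eLpNorm p q volume := by
  have h := (measurableEmbedding_mulLeft₀ hc).eLpNorm_map_measure
    (g := p) (p := q) (μ := volume)
  rw [Real.map_volume_mul_left hc, eLpNorm_smul_measure_of_ne_top hq] at h
  exact h.symm

theorem memLp_comp_mul_left_iff (hc : c ≠ 0) {p : ℝ → E} {q : ℝ≥0∞} :
    MemLp (fun x => p (c * x)) q ↔ MemLp p q := by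
  have hdilate : ∀ {b : ℝ} {r : ℝ → E}, b ≠ 0 → MemLp r q → MemLp (fun x => r (b * x)) q := by
    intro b r hb hr
    rw [← Function.comp_def r, ← (measurableEmbedding_mulLeft₀ hb).memLp_map_measure_iff,
      Real.map_volume_mul_left hb]
    exact hr.smul_measure ENNReal.ofReal_ne_top
  refine ⟨fun h => ?_, hdilate hc⟩
  simpa only [mul_inv_cancel_left₀ hc] using hdilate (inv_ne_zero hc) h

theorem tendsto_eLpNorm_comp_mul_left_iff (hc : c ≠ 0) {ι : Type*} {l : Filter ι}
    {p : ι → ℝ → E} {q : ℝ≥0∞} (hq : q ≠ ∞) :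
    Tendsto (fun i => eLpNorm (fun x => p i (c * x)) q volume) l (𝓝 0) ↔
      Tendsto (fun i => eLpNorm (p i) q volume) l (𝓝 0) := by
  have hdilate : ∀ {b : ℝ} {r : ι → ℝ → E}, b ≠ 0 →
      Tendsto (fun i => eLpNorm (r i) q volume) l (𝓝 0) →
      Tendsto (fun i => eLpNorm (fun x => r i (b * x)) q volume) l (𝓝 0) := by
    intro b r hb h
    simp only [eLpNorm_comp_mul_left hb _ hq]
    rw [← mul_zero (ENNReal.ofReal |b⁻¹| ^ (1 / q).toReal)]
    exact ENNReal.Tendsto.const_mul h (Or.inr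
      (ENNReal.rpow_ne_top_of_nonneg ENNReal.toReal_nonneg ENNReal.ofReal_ne_top))
  refine ⟨fun h => ?_, hdilate hc⟩
  simpa only [mul_inv_cancel_left₀ hc] using hdilate (inv_ne_zero hc) h

theorem locallyIntegrable_comp_mul_left_iff (hc : c ≠ 0) {p : ℝ → E} :
    LocallyIntegrable (fun x => p (c * x)) ↔ LocallyIntegrable p := by
  have hdilate : ∀ {b : ℝ} {r : ℝ → E}, b ≠ 0 → LocallyIntegrable r →
      LocallyIntegrable fun x => r (b * x) := by
    intro b r hb hr
    have h : LocallyIntegrable r (volume.map (Homeomorph.mulLeft₀ b hb)) := by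
      change LocallyIntegrable r (volume.map fun x => b * x)
      rw [Real.map_volume_mul_left hb]
      intro x
      obtain ⟨s, hs, hrs⟩ := hr x
      refine ⟨s, hs, ?_⟩
      rw [IntegrableOn, Measure.restrict_smul]
      exact hrs.smul_measure ENNReal.ofReal_ne_top
    exact (locallyIntegrable_map_homeomorph _).1 h
  refine ⟨fun h => ?_, hdilate hc⟩
  simpa only [mul_inv_cancel_left₀ hc] using hdilate (inv_ne_zero hc) h

end Dilation

section Truncation

variable {α E ι : Type*} [MeasurableSpace α] {μ : Measure α} [NormedAddCommGroup E] {p : ℝ≥0∞}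
  {l : Filter ι} [l.IsCountablyGenerated] {φ : ι → Set α}

theorem tendsto_eLpNorm_indicator_sub (hφ : AECover μ l φ) {g : α → E} (hp0 : p ≠ 0)
    (hp : p ≠ ∞) (hg : MemLp g p μ) :
    Tendsto (fun i => eLpNorm ((φ i).indicator g - g) p μ) l (𝓝 0) := by
  have hp_pos : 0 < p.toReal := ENNReal.toReal_pos hp0 hp
  have hdom : Tendsto (fun i => ∫⁻ x, ‖((φ i).indicator g - g) x‖ₑ ^ p.toReal ∂μ) l
      (𝓝 (∫⁻ _, 0 ∂μ)) := by
    refine tendsto_lintegral_filter_of_dominated_convergence' (fun x => ‖g x‖ₑ ^ p.toReal)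
      (.of_forall fun i => ((hg.1.indicator (hφ.measurableSet i)).sub hg.1).enorm.pow_const _)
      (.of_forall fun i => .of_forall fun x => ?_)
      (lintegral_rpow_enorm_lt_top_of_eLpNorm_lt_top hp0 hp hg.2).ne ?_
    · by_cases hx : x ∈ φ i <;> simp [hx, hp_pos]
    · filter_upwards [hφ.ae_eventually_mem] with x hx
      refine tendsto_const_nhds.congr' ?_
      filter_upwards [hx] with i hi
      simp [hi, hp_pos]
  rw [lintegral_zero] at hdom
  have hroot := (ENNReal.continuous_rpow_const (y := 1 / p.toReal)).tendsto 0 |>.comp hdom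
  rw [ENNReal.zero_rpow_of_pos (one_div_pos.2 hp_pos)] at hroot
  exact hroot.congr fun i => (eLpNorm_eq_lintegral_rpow_enorm_toReal hp0 hp).symm

theorem ae_eq_of_tendsto_eLpNorm_indicator_sub [l.NeBot] (hφ : AECover μ l φ) {g h : α → E}
    (hp0 : p ≠ 0) (hg : ∀ i, AEStronglyMeasurable ((φ i).indicator g) μ)
    (hh : AEStronglyMeasurable h μ)
    (hlim : Tendsto (fun i => eLpNorm ((φ i).indicator g - h) p μ) l (𝓝 0)) : g =ᵐ[μ] h := by
  obtain ⟨ns, hns, hae⟩ :=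
    (tendstoInMeasure_of_tendsto_eLpNorm hp0 hg hh hlim).exists_seq_tendsto_ae'
  filter_upwards [hae, hφ.ae_tendsto_indicator g] with x hxh hxg
  exact tendsto_nhds_unique (hxg.comp hns) hxh

end Truncation

section FourierTruncation

variable {V : Type*} [NormedAddCommGroup V] [InnerProductSpace ℝ V] [FiniteDimensional ℝ V]
  [MeasurableSpace V] [BorelSpace V] {ι : Type*} {l : Filter ι} [l.IsCountablyGenerated]
  {φ : ι → Set V} {g G : V → ℂ}

theorem eLpNorm_fourier_sub (a b : V →₂[volume] ℂ) :
    eLpNorm (⇑(𝓕 a : V →₂[volume] ℂ) - ⇑(𝓕 b : V →₂[volume] ℂ)) 2 volume =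
      eLpNorm (⇑a - ⇑b) 2 volume := by
  rw [← Lp.edist_def, ← Lp.edist_def]
  exact (Lp.fourierTransformₗᵢ V ℂ).isometry.edist_eq a b

theorem eLpNorm_fourierInv_sub (a b : V →₂[volume] ℂ) :
    eLpNorm (⇑(𝓕⁻ a : V →₂[volume] ℂ) - ⇑(𝓕⁻ b : V →₂[volume] ℂ)) 2 volume =
      eLpNorm (⇑a - ⇑b) 2 volume := by
  rw [← eLpNorm_fourier_sub, FourierTransform.fourier_fourierInv_eq,
    FourierTransform.fourier_fourierInv_eq]

theorem tendsto_eLpNorm_fourier_indicator_sub (hφ : AECover volume l φ) (hg : MemLp g 2)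
    (hi : ∀ i, IntegrableOn g (φ i)) :
    Tendsto (fun i => eLpNorm (𝓕 ((φ i).indicator g) - ⇑(𝓕 (hg.toLp g) : V →₂[volume] ℂ)) 2
      volume) l (𝓝 0) := by
  refine (tendsto_eLpNorm_indicator_sub hφ two_ne_zero ENNReal.ofNat_ne_top hg).congr fun i => ?_
  have hgi := hg.indicator (hφ.measurableSet i)
  rw [← eLpNorm_congr_ae ((fourier_toLp_ae_eq
    ((integrable_indicator_iff (hφ.measurableSet i)).2 (hi i)) hgi).sub (.refl _ _)),
    eLpNorm_fourier_sub, eLpNorm_congr_ae (hgi.coeFn_toLp.sub hg.coeFn_toLp)]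

theorem tendsto_eLpNorm_fourierInv_indicator_sub (hφ : AECover volume l φ) (hG : MemLp G 2)
    (hi : ∀ i, IntegrableOn G (φ i)) :
    Tendsto (fun i => eLpNorm (𝓕⁻ ((φ i).indicator G) - ⇑(𝓕⁻ (hG.toLp G) : V →₂[volume] ℂ)) 2
      volume) l (𝓝 0) := by
  refine (tendsto_eLpNorm_indicator_sub hφ two_ne_zero ENNReal.ofNat_ne_top hG).congr fun i => ?_
  have hGi := hG.indicator (hφ.measurableSet i)
  rw [eLpNorm_congr_ae ((fourierInv_toLp_ae_eq
    ((integrable_indicator_iff (hφ.measurableSet i)).2 (hi i)) hGi).sub (.refl _ _)),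
    eLpNorm_fourierInv_sub, eLpNorm_congr_ae (hGi.coeFn_toLp.sub hG.coeFn_toLp)]

theorem ae_eq_fourier_of_tendsto_eLpNorm_fourierInv [l.NeBot] (hφ : AECover volume l φ)
    (a : V →₂[volume] ℂ) (hi : ∀ i, IntegrableOn G (φ i))
    (hlim : Tendsto (fun i => eLpNorm (𝓕⁻ ((φ i).indicator G) - ⇑a) 2 volume) l (𝓝 0)) :
    G =ᵐ[volume] (𝓕 a : V →₂[volume] ℂ) := by
  have hGi : ∀ i, Integrable ((φ i).indicator G) := fun i =>
    (integrable_indicator_iff (hφ.measurableSet i)).2 (hi i)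
  refine ae_eq_of_tendsto_eLpNorm_indicator_sub hφ two_ne_zero (fun i => (hGi i).1)
    (Lp.aestronglyMeasurable _) (hlim.congr' ?_)
  filter_upwards [hlim.eventually (gt_mem_nhds ENNReal.zero_lt_top)] with i hfin
  have hmem : MemLp (𝓕⁻ ((φ i).indicator G)) 2 := by
    have hsub : MemLp (𝓕⁻ ((φ i).indicator G) - ⇑a) 2 :=
      ⟨(continuous_fourierInv_of_integrable (hGi i)).aestronglyMeasurable.sub
        (Lp.aestronglyMeasurable a), hfin⟩
    simpa only [sub_add_cancel] using hsub.add (Lp.memLp a)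
  rw [eLpNorm_congr_ae ((ae_eq_fourier_of_fourierInv_ae_eq (hGi i) (hmem.toLp _)
    hmem.coeFn_toLp.symm).sub (.refl _ _)), eLpNorm_fourier_sub,
    eLpNorm_congr_ae (hmem.coeFn_toLp.sub (.refl _ _))]

end FourierTruncation

section MellinTransform

/-- The `L²` Mellin transform of `f` at the point `1/2 + 2πiξ` of the critical line, realized as
the Fourier transform of `f` in the logarithmic variable. -/
noncomputable def mellinL2 {f : ℝ → ℂ} (hf : MemL2HalfLine f) : ℝ →₂[volume] ℂ :=
  𝓕 ((memLp_logPull hf).toLp _)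

theorem setIntegral_mul_cpow_eq_fourier (f : ℝ → ℂ) {N : ℝ} (hN : 0 < N) (ξ : ℝ) :
    ∫ t in Icc (1 / N) N, f t * (t : ℂ) ^ (critPt (2 * Real.pi * ξ) - 1) =
      𝓕 ((Icc (-Real.log N) (Real.log N)).indicator (logPull f)) ξ := by
  have hpos : Icc (1 / N) N ⊆ Ioi 0 := fun t ht => (one_div_pos.2 hN).trans_le ht.1
  have hmem : ∀ u : ℝ, Real.exp (-u) ∈ Icc (1 / N) N ↔ u ∈ Icc (-Real.log N) (Real.log N) := by
    intro u
    rw [mem_Icc, mem_Icc, ← Real.log_le_iff_le_exp (one_div_pos.2 hN), ← Real.le_log_iff_exp_le hN,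
      one_div, Real.log_inv, neg_le_neg_iff, neg_le, and_comm]
  rw [← inter_eq_right.2 hpos, ← setIntegral_indicator measurableSet_Icc,
    integral_Ioi_eq_integral_exp_neg, Real.fourier_real_eq_integral_exp_smul]
  congr 1 with u
  by_cases hu : u ∈ Icc (-Real.log N) (Real.log N)
  · rw [indicator_of_mem hu, indicator_of_mem ((hmem u).2 hu), ofReal_exp_cpow, logPull,
      smul_eq_mul, Complex.real_smul, Complex.ofReal_exp, Complex.ofReal_exp, mul_left_comm,
      ← Complex.exp_add, ← mul_assoc, ← Complex.exp_add, mul_comm (f _)]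
    congr 2
    rw [critPt]
    push_cast
    ring
  · rw [indicator_of_notMem hu, indicator_of_notMem (fun h => hu ((hmem u).1 h)), smul_zero,
      smul_zero]

theorem isMellinTransformL2_iff {f : ℝ → ℂ} (hf : MemL2HalfLine f) (F : ℂ → ℂ) :
    IsMellinTransformL2 f F ↔
      (fun ξ : ℝ => F (critPt (2 * Real.pi * ξ))) =ᵐ[volume] mellinL2 hf := by
  have hcover : AECover volume atTop fun N : ℝ => Icc (-Real.log N) (Real.log N) :=
    aecover_Icc (tendsto_neg_atTop_atBot.comp Real.tendsto_log_atTop) Real.tendsto_log_atTop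
  have hint : ∀ N : ℝ, IntegrableOn (logPull f) (Icc (-Real.log N) (Real.log N)) := fun N =>
    ((memLp_logPull hf).locallyIntegrable one_le_two).integrableOn_isCompact isCompact_Icc
  have hlim := tendsto_eLpNorm_fourier_indicator_sub hcover (memLp_logPull hf) hint
  have hrescale : Tendsto (fun N : ℝ => eLpNorm (fun τ : ℝ =>
      (∫ t in Icc (1 / N) N, f t * (t : ℂ) ^ (critPt τ - 1)) - F (critPt τ)) 2 volume)
        atTop (𝓝 0) ↔
      Tendsto (fun N => eLpNorm (𝓕 ((Icc (-Real.log N) (Real.log N)).indicator (logPull f)) -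
        fun ξ : ℝ => F (critPt (2 * Real.pi * ξ))) 2 volume) atTop (𝓝 0) := by
    rw [← tendsto_eLpNorm_comp_mul_left_iff Real.two_pi_pos.ne' ENNReal.ofNat_ne_top]
    refine tendsto_congr' ?_
    filter_upwards [eventually_gt_atTop 0] with N hN
    simp only [setIntegral_mul_cpow_eq_fourier f hN]
    rfl
  rw [IsMellinTransformL2, hrescale, ← memLp_comp_mul_left_iff Real.two_pi_pos.ne']
  constructor
  · rintro ⟨hF, hFlim⟩
    have hmeas : ∀ N : ℝ, AEStronglyMeasurable
        (𝓕 ((Icc (-Real.log N) (Real.log N)).indicator (logPull f))) := fun N =>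
      (continuous_fourier_of_integrable
        ((integrable_indicator_iff measurableSet_Icc).2 (hint N))).aestronglyMeasurable
    exact tendstoInMeasure_ae_unique
      (tendstoInMeasure_of_tendsto_eLpNorm two_ne_zero hmeas hF.1 hFlim)
      (tendstoInMeasure_of_tendsto_eLpNorm two_ne_zero hmeas (Lp.aestronglyMeasurable _) hlim)
  · intro h
    exact ⟨(memLp_congr_ae h).2 (Lp.memLp _),
      hlim.congr fun N => eLpNorm_congr_ae (EventuallyEq.rfl.sub h.symm)⟩

theorem logPull_setIntegral_mul_cpow_eq_fourierInv (F : ℂ → ℂ) (N u : ℝ) :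
    logPull (fun x => 1 / (2 * (Real.pi : ℂ)) *
      ∫ τ in Icc (-N) N, F (critPt τ) * (x : ℂ) ^ (-critPt τ)) u =
      𝓕⁻ ((Icc (-(N / (2 * Real.pi))) (N / (2 * Real.pi))).indicator
        fun ξ : ℝ => F (critPt (2 * Real.pi * ξ))) u := by
  have hπ := Real.two_pi_pos
  have hmem : ∀ ξ : ℝ, 2 * Real.pi * ξ ∈ Icc (-N) N ↔
      ξ ∈ Icc (-(N / (2 * Real.pi))) (N / (2 * Real.pi)) := by
    intro ξ
    rw [mem_Icc, mem_Icc, ← neg_div, div_le_iff₀' hπ, le_div_iff₀' hπ]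
  have hscale := Measure.integral_comp_mul_left (fun τ : ℝ => (Icc (-N) N).indicator
    (fun τ : ℝ => F (critPt τ) * ((Real.exp (-u) : ℝ) : ℂ) ^ (-critPt τ)) τ) (2 * Real.pi)
  rw [abs_of_pos (inv_pos.2 hπ), Complex.real_smul] at hscale
  rw [logPull, ← integral_indicator measurableSet_Icc, Real.fourierInv_eq',
    show (1 / (2 * (Real.pi : ℂ))) = (((2 * Real.pi)⁻¹ : ℝ) : ℂ) by push_cast; ring, ← hscale,
    ← integral_const_mul]
  congr 1 with ξ
  by_cases hξ : ξ ∈ Icc (-(N / (2 * Real.pi))) (N / (2 * Real.pi))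
  · rw [indicator_of_mem hξ, indicator_of_mem ((hmem ξ).2 hξ), ofReal_exp_cpow, smul_eq_mul,
      Complex.ofReal_exp, mul_left_comm, ← Complex.exp_add, mul_comm]
    congr 2
    rw [critPt, RCLike.inner_apply, conj_trivial]
    push_cast
    ring
  · rw [indicator_of_notMem hξ, indicator_of_notMem (fun h => hξ ((hmem ξ).1 h)), mul_zero,
      smul_zero]

theorem isMeanSquareMellinIntegral_iff {f : ℝ → ℂ} (hf : MemL2HalfLine f) (F : ℂ → ℂ) :
    IsMeanSquareMellinIntegral F f ↔
      (fun ξ : ℝ => F (critPt (2 * Real.pi * ξ))) =ᵐ[volume] mellinL2 hf := by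
  have htop : Tendsto (fun N : ℝ => N / (2 * Real.pi)) atTop atTop :=
    tendsto_id.atTop_div_const Real.two_pi_pos
  have hcover : AECover volume atTop fun N : ℝ => Icc (-(N / (2 * Real.pi))) (N / (2 * Real.pi)) :=
    aecover_Icc (tendsto_neg_atTop_atBot.comp htop) htop
  have hlog : Tendsto (fun N : ℝ => eLpNorm (fun x : ℝ => f x - 1 / (2 * (Real.pi : ℂ)) *
      ∫ τ in Icc (-N) N, F (critPt τ) * (x : ℂ) ^ (-critPt τ)) 2
        (volume.restrict (Ioi (0 : ℝ)))) atTop (𝓝 0) ↔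
      Tendsto (fun N => eLpNorm (𝓕⁻ ((Icc (-(N / (2 * Real.pi))) (N / (2 * Real.pi))).indicator
        fun ξ : ℝ => F (critPt (2 * Real.pi * ξ))) - ⇑((memLp_logPull hf).toLp _)) 2 volume)
        atTop (𝓝 0) := by
    refine tendsto_congr fun N => ?_
    rw [← eLpNorm_logPull, eLpNorm_sub_comm]
    refine eLpNorm_congr_ae ?_
    filter_upwards [(memLp_logPull hf).coeFn_toLp] with u hu
    rw [Pi.sub_apply, hu, ← logPull_setIntegral_mul_cpow_eq_fourierInv]
    exact mul_sub _ _ _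
  rw [IsMeanSquareMellinIntegral, hlog, ← locallyIntegrable_comp_mul_left_iff Real.two_pi_pos.ne']
  constructor
  · rintro ⟨hloc, hlim⟩
    exact ae_eq_fourier_of_tendsto_eLpNorm_fourierInv hcover _
      (fun N => hloc.integrableOn_isCompact isCompact_Icc) hlim
  · intro h
    have hmem : MemLp (fun ξ : ℝ => F (critPt (2 * Real.pi * ξ))) 2 :=
      (memLp_congr_ae h).2 (Lp.memLp _)
    have hloc := hmem.locallyIntegrable one_le_two
    have hinv : 𝓕⁻ (hmem.toLp _) = (memLp_logPull hf).toLp _ := by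
      rw [show hmem.toLp _ = mellinL2 hf from Lp.ext (hmem.coeFn_toLp.trans h)]
      exact FourierTransform.fourierInv_fourier_eq _
    refine ⟨hloc, ?_⟩
    rw [← hinv]
    exact tendsto_eLpNorm_fourierInv_indicator_sub hcover hmem fun N =>
      hloc.integrableOn_isCompact isCompact_Icc

end MellinTransform

section PrincipalValue

theorem measurableSet_truncation (a ε : ℝ) : MeasurableSet {t : ℝ | 0 < t ∧ ε < |t - a|} :=
  measurableSet_Ioi.inter (measurableSet_lt measurable_const
    (by fun_prop : Measurable fun t : ℝ => |t - a|))

variable {k k' : ℝ → ℂ} {a : ℝ} {v v' : ℂ}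

theorem HasPVIntegral.unique (h : HasPVIntegral k a v) (h' : HasPVIntegral k a v') : v = v' :=
  tendsto_nhds_unique h.2 h'.2

theorem HasPVIntegral.const_mul (h : HasPVIntegral k a v) (d : ℂ) :
    HasPVIntegral (fun t => d * k t) a (d * v) :=
  ⟨fun ε hε => (h.1 ε hε).const_mul d, by
    simpa only [integral_const_mul] using h.2.const_mul d⟩

theorem HasPVIntegral.add (h : HasPVIntegral k a v) (h' : HasPVIntegral k' a v') :
    HasPVIntegral (fun t => k t + k' t) a (v + v') := by
  refine ⟨fun ε hε => (h.1 ε hε).add (h'.1 ε hε), (h.2.add h'.2).congr' ?_⟩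
  filter_upwards [self_mem_nhdsWithin] with ε hε
  exact (integral_add (h.1 ε hε) (h'.1 ε hε)).symm

theorem HasPVIntegral.congr (h : HasPVIntegral k a v) (hk : ∀ t, 0 < t → t ≠ a → k t = k' t) :
    HasPVIntegral k' a v := by
  have heq : ∀ ε : ℝ, 0 < ε → EqOn k k' {t : ℝ | 0 < t ∧ ε < |t - a|} := fun ε hε t ht =>
    hk t ht.1 (sub_ne_zero.1 (abs_pos.1 (hε.trans ht.2)))
  refine ⟨fun ε hε => (h.1 ε hε).congr_fun (heq ε hε) (measurableSet_truncation a ε),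
    h.2.congr' ?_⟩
  filter_upwards [self_mem_nhdsWithin] with ε hε
  exact setIntegral_congr_fun (measurableSet_truncation a ε) (heq ε hε)

theorem HasPVIntegral.const_mul_iff {d : ℂ} (hd : d ≠ 0) :
    HasPVIntegral (fun t => d * k t) a (d * v) ↔ HasPVIntegral k a v := by
  refine ⟨fun h => ?_, fun h => h.const_mul d⟩
  simpa only [inv_mul_cancel_left₀ hd] using h.const_mul d⁻¹

theorem aecover_truncation (a : ℝ) :
    AECover (volume.restrict (Ioi 0)) (𝓝[>] 0) fun ε : ℝ => {t : ℝ | 0 < t ∧ ε < |t - a|} where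
  ae_eventually_mem := by
    filter_upwards [ae_restrict_mem measurableSet_Ioi, ae_restrict_of_ae (volume.ae_ne a)]
      with t ht hta
    filter_upwards [Ioo_mem_nhdsGT (abs_pos.2 (sub_ne_zero.2 hta))] with ε hε using ⟨ht, hε.2⟩
  measurableSet := measurableSet_truncation a

theorem hasPVIntegral_of_integrableOn (hk : IntegrableOn k (Ioi 0)) (a : ℝ) :
    HasPVIntegral k a (∫ t in Ioi 0, k t) := by
  have hsub : ∀ ε, {t : ℝ | 0 < t ∧ ε < |t - a|} ⊆ Ioi 0 := fun ε t ht => ht.1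
  refine ⟨fun ε _ => hk.mono_set (hsub ε), ?_⟩
  simpa only [Measure.restrict_restrict (measurableSet_truncation a _),
    inter_eq_left.2 (hsub _)] using
    (aecover_truncation a).integral_tendsto_of_countably_generated hk

variable {f : ℝ → ℂ} {x : ℝ}

theorem hasPVIntegral_div_sub (hf : MemL2HalfLine f)
    (h : Tendsto (fun ε => ∫ t in Ioi 0, f t * (truncKer ε (x - t) : ℂ)) (𝓝[>] 0) (𝓝 v)) :
    HasPVIntegral (fun t => f t / ((x : ℂ) - t)) x v := by
  have heq : ∀ ε, EqOn (fun t => f t * (truncKer ε (x - t) : ℂ))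
      ({t : ℝ | 0 < t ∧ ε < |t - x|}.indicator fun t => f t / ((x : ℂ) - t)) (Ioi 0) :=
    fun ε t ht => by
      simp only [indicator, mem_ofPred_eq, mem_Ioi.1 ht, true_and, truncKer, abs_sub_comm x t]
      split_ifs
      · push_cast
        rw [mul_one_div]
      · rw [Complex.ofReal_zero, mul_zero]
  have hsub : ∀ ε, {t : ℝ | 0 < t ∧ ε < |t - x|} ⊆ Ioi 0 := fun ε t ht => ht.1
  refine ⟨fun ε hε => ?_, h.congr fun ε => ?_⟩
  · have hint : IntegrableOn (fun t => f t * (truncKer ε (x - t) : ℂ)) (Ioi 0) :=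
      MemLp.integrable_mul hf ((memLp_truncKer hε x).restrict _)
    have := (integrableOn_congr_fun (heq ε) measurableSet_Ioi).1 hint
    rwa [IntegrableOn, integrable_indicator_iff (measurableSet_truncation x ε), IntegrableOn,
      Measure.restrict_restrict (measurableSet_truncation x ε), inter_eq_left.2 (hsub ε)] at this
  · rw [setIntegral_congr_fun measurableSet_Ioi (heq ε),
      setIntegral_indicator (measurableSet_truncation x ε), inter_eq_right.2 (hsub ε)]

theorem integrableOn_div_add (hf : MemL2HalfLine f) (hx : 0 < x) :
    IntegrableOn (fun t => f t / ((x : ℂ) + t)) (Ioi 0) := by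
  have hker : MemLp (fun t => (truncKer (x / 2) (x - -t) : ℂ)) 2 :=
    (memLp_truncKer (half_pos hx) x).comp_measurePreserving (Measure.measurePreserving_neg volume)
  refine IntegrableOn.congr_fun (MemLp.integrable_mul hf (hker.restrict _)) (fun t ht => ?_)
    measurableSet_Ioi
  have ht0 : 0 < t := ht
  simp only [Pi.mul_apply]
  rw [truncKer, sub_neg_eq_add, if_pos (by rw [abs_of_pos (by positivity)]; linarith)]
  push_cast
  rw [mul_one_div]

end PrincipalValue

section ParityExtension

/-- The extension of `f` from `(0, ∞)` to the real line which is even for `c = 1` and odd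
for `c = -1`. -/
noncomputable def parityExt (c : ℂ) (f : ℝ → ℂ) (t : ℝ) : ℂ :=
  (Ioi (0 : ℝ)).indicator f t + c * (Ioi (0 : ℝ)).indicator f (-t)

variable {f : ℝ → ℂ} {c : ℂ}

theorem parityExt_neg (hc : c * c = 1) (f : ℝ → ℂ) (t : ℝ) :
    parityExt c f (-t) = c * parityExt c f t := by
  simp only [parityExt, neg_neg]
  linear_combination (-(Ioi (0 : ℝ)).indicator f (-t)) * hc

theorem parityExt_of_pos (c : ℂ) (f : ℝ → ℂ) {t : ℝ} (ht : 0 < t) : parityExt c f t = f t := by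
  rw [parityExt, indicator_of_mem (mem_Ioi.2 ht),
    indicator_of_notMem (notMem_Ioi.2 (neg_nonpos.2 ht.le)), mul_zero, add_zero]

theorem MemL2HalfLine.memLp_indicator (hf : MemL2HalfLine f) :
    MemLp ((Ioi (0 : ℝ)).indicator f) 2 :=
  (memLp_indicator_iff_restrict measurableSet_Ioi).2 hf

theorem memLp_parityExt (c : ℂ) (hf : MemL2HalfLine f) : MemLp (parityExt c f) 2 :=
  hf.memLp_indicator.add ((hf.memLp_indicator.comp_measurePreserving
    (Measure.measurePreserving_neg volume)).const_mul c)

theorem integral_parityExt_mul (c : ℂ) {k : ℝ → ℂ} (hf : MemL2HalfLine f) (hk : MemLp k 2) :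
    ∫ t, parityExt c f t * k t =
      (∫ t in Ioi 0, f t * k t) + c * ∫ t in Ioi 0, f t * k (-t) := by
  have hneg := Measure.measurePreserving_neg (volume : Measure ℝ)
  have hright : Integrable fun t => (Ioi (0 : ℝ)).indicator f t * k t :=
    hf.memLp_indicator.integrable_mul hk
  have hleft : Integrable fun t => (Ioi (0 : ℝ)).indicator f (-t) * k t :=
    (hf.memLp_indicator.comp_measurePreserving hneg).integrable_mul hk
  simp only [parityExt, add_mul, mul_assoc]
  rw [integral_add hright (hleft.const_mul c), integral_const_mul,
    ← integral_neg_eq_self fun t => (Ioi (0 : ℝ)).indicator f (-t) * k t]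
  simp only [neg_neg, ← indicator_mul_left _ f k, ← indicator_mul_left _ f fun t => k (-t),
    integral_indicator measurableSet_Ioi]

/-- The extension `parityExt c f` as an element of `L²(ℝ)`. -/
noncomputable def parityLp (c : ℂ) (hf : MemL2HalfLine f) : ℝ →₂[volume] ℂ :=
  (memLp_parityExt c hf).toLp _

theorem coeFn_parityLp (c : ℂ) (hf : MemL2HalfLine f) : parityLp c hf =ᵐ[volume] parityExt c f :=
  (memLp_parityExt c hf).coeFn_toLp

theorem parityLp_neg_ae_eq (hc : c * c = 1) (hf : MemL2HalfLine f) :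
    ∀ᵐ t, parityLp c hf (-t) = c * parityLp c hf t := by
  filter_upwards [coeFn_parityLp c hf, ae_comp_neg (coeFn_parityLp c hf)] with t ht hnt
  rw [ht, hnt, parityExt_neg hc]

theorem setIntegral_parityLp_mul (c : ℂ) (hf : MemL2HalfLine f) (k : ℝ → ℂ) :
    ∫ t in Ioi 0, parityLp c hf t * k t = ∫ t in Ioi 0, f t * k t := by
  refine setIntegral_congr_ae measurableSet_Ioi ?_
  filter_upwards [coeFn_parityLp c hf] with t ht ht0
  rw [ht, parityExt_of_pos c f ht0]

theorem hasPVIntegral_of_tendsto_parityExt (hf : MemL2HalfLine f) {x : ℝ} (hx : 0 < x) {v : ℂ}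
    (h : Tendsto (fun ε => ∫ t, parityExt c f t * (truncKer ε (x - t) : ℂ)) (𝓝[>] 0) (𝓝 v)) :
    HasPVIntegral (fun t => f t / ((x : ℂ) - t) + c * (f t / ((x : ℂ) + t))) x v := by
  have hsum : ∀ᶠ ε in 𝓝[>] (0 : ℝ), (∫ t, parityExt c f t * (truncKer ε (x - t) : ℂ)) -
      c * ∫ t in Ioi 0, f t / ((x : ℂ) + t) =
        ∫ t in Ioi 0, f t * (truncKer ε (x - t) : ℂ) := by
    filter_upwards [Ioo_mem_nhdsGT hx] with ε hε
    rw [integral_parityExt_mul c hf (memLp_truncKer hε.1 x), sub_eq_iff_eq_add]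
    congr 2
    refine setIntegral_congr_fun measurableSet_Ioi fun t ht => ?_
    have ht0 : 0 < t := ht
    have hfar : ε < |x + t| := by
      rw [abs_of_pos (by positivity)]
      linarith [hε.2]
    simp only [truncKer, sub_neg_eq_add, if_pos hfar]
    push_cast
    rw [mul_one_div]
  have hsing := hasPVIntegral_div_sub hf ((h.sub_const _).congr' hsum)
  have hreg := (hasPVIntegral_of_integrableOn (integrableOn_div_add hf hx) x).const_mul c
  simpa only [sub_add_cancel] using hsing.add hreg

theorem ae_hasPVIntegral_hilbertL2_parityLp (c : ℂ) (hf : MemL2HalfLine f) :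
    ∀ᵐ x : ℝ ∂volume.restrict (Ioi (0 : ℝ)),
      HasPVIntegral (fun t => f t / ((x : ℂ) - t) + c * (f t / ((x : ℂ) + t))) x
        (Real.pi * hilbertL2 (parityLp c hf) x) := by
  rw [ae_restrict_iff' measurableSet_Ioi]
  filter_upwards [ae_tendsto_integral_mul_truncKer_hilbertL2 (parityLp c hf)] with x hx hx0
  refine hasPVIntegral_of_tendsto_parityExt hf hx0 (hx.congr fun ε => integral_congr_ae ?_)
  filter_upwards [coeFn_parityLp c hf] with t ht
  rw [ht]

end ParityExtension

section StieltjesIdentities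

theorem integral_eq_two_mul_setIntegral_Ioi_of_even {g : ℝ → ℂ} (hg : Integrable g)
    (heven : ∀ᵐ t, g (-t) = g t) : ∫ t, g t = 2 * ∫ t in Ioi 0, g t := by
  have hneg : ∫ t in Iic 0, g t = ∫ t in Ioi 0, g t := by
    rw [← neg_zero, ← integral_comp_neg_Ioi, neg_zero]
    exact integral_congr_ae (ae_restrict_of_ae heven)
  rw [← intervalIntegral.integral_Iic_add_Ioi hg.integrableOn hg.integrableOn, hneg, two_mul]

theorem poissonKer_neg (ε w : ℝ) : poissonKer ε (-w) = poissonKer ε w := by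
  rw [poissonKer, poissonKer, neg_sq]

theorem setIntegral_mul_conjPoissonKer_eq {p q : ℝ → ℂ} (hp : MemLp p 2) (hq : MemLp q 2)
    (hodd : ∀ᵐ t, p (-t) = -p t) (heven : ∀ᵐ t, q (-t) = q t) {ε : ℝ} (hε : 0 < ε)
    (h : ∫ t, p t * (conjPoissonKer ε (0 - t) : ℂ) = -∫ t, q t * (poissonKer ε (0 - t) : ℂ)) :
    ∫ t in Ioi 0, p t * (conjPoissonKer ε t : ℂ) = ∫ t in Ioi 0, q t * (poissonKer ε t : ℂ) := by
  have hpint : Integrable fun t => -(p t * (conjPoissonKer ε (0 - t) : ℂ)) :=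
    (hp.integrable_mul (memLp_conjPoissonKer hε 0)).neg
  have hqint : Integrable fun t => q t * (poissonKer ε (0 - t) : ℂ) :=
    hq.integrable_mul (memLp_poissonKer hε 0)
  simp only [zero_sub, conjPoissonKer_neg, poissonKer_neg, Complex.ofReal_neg, mul_neg,
    neg_neg] at h hpint hqint
  rw [integral_neg, neg_inj, integral_eq_two_mul_setIntegral_Ioi_of_even hpint ?_,
    integral_eq_two_mul_setIntegral_Ioi_of_even hqint ?_] at h
  · exact mul_left_cancel₀ two_ne_zero h
  · filter_upwards [heven] with t ht
    rw [ht, poissonKer_neg]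
  · filter_upwards [hodd] with t ht
    rw [ht, conjPoissonKer_neg, Complex.ofReal_neg, neg_mul_neg]

theorem poissonKer_eq_conjPoissonKer (ε w : ℝ) : poissonKer ε w = conjPoissonKer w ε := by
  rw [poissonKer, conjPoissonKer, add_comm]

theorem conjPoissonKer_exp_neg (u v : ℝ) :
    conjPoissonKer (Real.exp (-v)) (Real.exp (-u)) =
      Real.exp ((u + v) / 2) * logKer (u - v) := by
  have hden : Real.exp (-u) ^ 2 + Real.exp (-v) ^ 2 =
      Real.exp (-(u + v)) * (Real.exp (u - v) + Real.exp (-(u - v))) := by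
    rw [mul_add, ← Real.exp_add, ← Real.exp_add, ← Real.exp_nat_mul, ← Real.exp_nat_mul, add_comm]
    push_cast
    ring_nf
  rw [conjPoissonKer, logKer, hden, mul_div_assoc', ← div_div, ← Real.exp_sub, ← Real.exp_add]
  ring_nf

theorem setIntegral_Ioi_mul_eq_integral_logPull (p : ℝ → ℂ) {K L : ℝ → ℝ} {v : ℝ}
    (hK : ∀ u, K (Real.exp (-u)) = Real.exp ((u + v) / 2) * L u) :
    ∫ t in Ioi 0, p t * (K t : ℂ) =
      (Real.exp (v / 2) : ℂ) * ∫ u, logPull p u * (L u : ℂ) := by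
  have hexp : ∀ u : ℝ,
      Real.exp (-u) * Real.exp ((u + v) / 2) = Real.exp (v / 2) * Real.exp (-u / 2) := fun u => by
    rw [← Real.exp_add, ← Real.exp_add]
    ring_nf
  rw [integral_Ioi_eq_integral_exp_neg, ← integral_const_mul]
  congr 1 with u
  rw [hK, logPull, Complex.real_smul]
  push_cast
  linear_combination (norm := (push_cast; ring)) p (Real.exp (-u)) * L u *
    congrArg Complex.ofReal (hexp u)

theorem integral_toLp_mul {p : ℝ → ℂ} (hp : MemLp p 2) (k : ℝ → ℂ) :
    ∫ t, hp.toLp p t * k t = ∫ t, p t * k t :=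
  integral_congr_ae (hp.coeFn_toLp.mono fun t ht => by simp only [ht])

theorem mellinL2_mul_critCos_ae_eq {p q : ℝ → ℂ} (hp : MemL2HalfLine p) (hq : MemL2HalfLine q)
    (h : ∀ ε : ℝ, 0 < ε → ∫ t in Ioi 0, p t * (conjPoissonKer ε t : ℂ) =
      ∫ t in Ioi 0, q t * (poissonKer ε t : ℂ)) :
    ∀ᵐ ξ, mellinL2 hp ξ * critCos ξ = mellinL2 hq ξ * critCos (-ξ) := by
  refine fourier_mul_critCos_ae_eq fun v => ?_
  rw [integral_toLp_mul, integral_toLp_mul]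
  have hv := h (Real.exp (-v)) (Real.exp_pos _)
  rw [setIntegral_Ioi_mul_eq_integral_logPull p fun u => conjPoissonKer_exp_neg u v,
    setIntegral_Ioi_mul_eq_integral_logPull (L := fun u => logKer (v - u)) q fun u => by
      rw [poissonKer_eq_conjPoissonKer, conjPoissonKer_exp_neg, add_comm]] at hv
  exact mul_left_cancel₀ (Complex.ofReal_ne_zero.2 (Real.exp_pos _).ne') hv

end StieltjesIdentities

section MellinConditions

variable {f : ℝ → ℂ} {den : ℂ → ℂ} {D : ℝ → ℂ}

theorem exists_symmetric_div_ae_eq_iff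
    (hD : ∀ ξ : ℝ, den (critPt (2 * Real.pi * ξ)) = D ξ) (hD0 : ∀ ξ, D ξ ≠ 0) (G : ℝ → ℂ) :
    (∃ φ : ℂ → ℂ, SymmetricOnCritLine φ ∧
      (fun ξ : ℝ => φ (critPt (2 * Real.pi * ξ)) / den (critPt (2 * Real.pi * ξ))) =ᵐ[volume] G) ↔
      ∀ᵐ ξ : ℝ, G (-ξ) * D (-ξ) = G ξ * D ξ := by
  have hre : ∀ τ : ℝ, (critPt τ).re = 1 / 2 := fun τ => by simp [critPt]
  have him : ∀ τ : ℝ, (critPt τ).im = τ := fun τ => by simp [critPt]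
  constructor
  · rintro ⟨φ, hφ, h⟩
    filter_upwards [h, ae_comp_neg h] with ξ h1 h2
    rw [← h1, ← h2, hD, hD, div_mul_cancel₀ _ (hD0 _), div_mul_cancel₀ _ (hD0 _), mul_neg,
      critPt_neg, ← hφ _ (hre _)]
  · intro h
    -- The product `G * D` is only a.e. symmetric; averaging makes `φ` symmetric everywhere.
    refine ⟨fun s => (G (s.im / (2 * Real.pi)) * D (s.im / (2 * Real.pi)) +
      G (-(s.im / (2 * Real.pi))) * D (-(s.im / (2 * Real.pi)))) / 2, fun s _ => ?_, ?_⟩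
    · simp only [Complex.sub_im, Complex.one_im, zero_sub, neg_div, neg_neg]
      rw [add_comm]
    · filter_upwards [h] with ξ hξ
      rw [him, mul_div_cancel_left₀ ξ Real.two_pi_pos.ne', hξ, hD, add_self_div_two,
        mul_div_cancel_right₀ _ (hD0 ξ)]

theorem tfae_mellin_conditions (hf : MemL2HalfLine f)
    (hD : ∀ ξ : ℝ, den (critPt (2 * Real.pi * ξ)) = D ξ) (hD0 : ∀ ξ, D ξ ≠ 0) {p q : Prop}
    (hp : p ↔ ∀ᵐ ξ : ℝ, mellinL2 hf (-ξ) * D (-ξ) = mellinL2 hf ξ * D ξ) (hpq : p ↔ q) :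
    List.TFAE [p, q,
      ∃ φ : ℂ → ℂ, SymmetricOnCritLine φ ∧ IsMeanSquareMellinIntegral (fun s => φ s / den s) f,
      ∃ φ : ℂ → ℂ, SymmetricOnCritLine φ ∧ IsMellinTransformL2 f (fun s => φ s / den s)] := by
  rw [← exists_symmetric_div_ae_eq_iff hD hD0] at hp
  tfae_have 1 ↔ 2 := hpq
  tfae_have 1 ↔ 3 := by simpa only [isMeanSquareMellinIntegral_iff hf] using hp
  tfae_have 1 ↔ 4 := by simpa only [isMellinTransformL2_iff hf] using hp
  tfae_finish

end MellinConditions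

section ReflectedEquation

variable {f w : ℝ → ℂ}

theorem one_div_mul_comp_one_div_ae_eq_iff (hf : MemL2HalfLine f) (hw : MemL2HalfLine w) :
    (∀ᵐ x : ℝ ∂volume.restrict (Ioi (0 : ℝ)), 1 / (x : ℂ) * f (1 / x) = w x) ↔
      ∀ᵐ ξ, mellinL2 hf (-ξ) = mellinL2 hw ξ := by
  have hlog : ∀ u : ℝ,
      (1 / ((Real.exp (-u) : ℝ) : ℂ) * f (1 / Real.exp (-u)) = w (Real.exp (-u))) ↔
        logPull f (-u) = logPull w u := fun u => by
    have hexp : Real.exp (u / 2) = Real.exp (-u / 2) * (1 / Real.exp (-u)) := by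
      rw [one_div, ← Real.exp_neg, ← Real.exp_add]
      ring_nf
    have hne : (Real.exp (-u / 2) : ℂ) ≠ 0 := Complex.ofReal_ne_zero.2 (Real.exp_pos _).ne'
    rw [logPull, logPull, neg_neg, hexp, ← one_div_one_div (Real.exp u), one_div (Real.exp u),
      ← Real.exp_neg, Complex.ofReal_mul, mul_assoc, mul_right_inj' hne, Complex.ofReal_div,
      Complex.ofReal_one]
  have hn : MemLp (fun u => logPull f (-u)) 2 :=
    (memLp_logPull hf).comp_measurePreserving (Measure.measurePreserving_neg volume)
  have hneg : (𝓕 (hn.toLp _) : ℝ →₂[volume] ℂ) =ᵐ[volume] fun ξ => mellinL2 hf (-ξ) := by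
    refine fourier_comp_linearIsometryEquiv_ae_eq (LinearIsometryEquiv.neg ℝ) ?_
    filter_upwards [hn.coeFn_toLp, ae_comp_neg (memLp_logPull hf).coeFn_toLp] with u h1 h2
    exact h1.trans h2.symm
  rw [ae_Ioi_iff_ae_exp_neg]
  simp only [hlog]
  calc (∀ᵐ u, logPull f (-u) = logPull w u)
      ↔ hn.toLp _ = (memLp_logPull hw).toLp _ := (MemLp.toLp_eq_toLp_iff hn _).symm
    _ ↔ 𝓕 (hn.toLp _) = mellinL2 hw := (Lp.fourierTransformₗᵢ ℝ ℂ).injective.eq_iff.symm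
    _ ↔ (𝓕 (hn.toLp _) : ℝ →₂[volume] ℂ) =ᵐ[volume] mellinL2 hw := Lp.ext_iff
    _ ↔ ∀ᵐ ξ, mellinL2 hf (-ξ) = mellinL2 hw ξ :=
      ⟨fun h => hneg.symm.trans h, fun h => hneg.trans h⟩

variable {k : ℝ → ℝ → ℂ}

theorem reflected_equation_iff_mellinL2 (hf : MemL2HalfLine f) (hw : MemL2HalfLine w) {D : ℝ → ℂ}
    (hPV : ∀ᵐ x : ℝ ∂volume.restrict (Ioi (0 : ℝ)), HasPVIntegral (k x) x (Real.pi / 2 * w x))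
    (hD0 : ∀ ξ, D ξ ≠ 0) (hmul : ∀ᵐ ξ, mellinL2 hf ξ * D ξ = mellinL2 hw ξ * D (-ξ)) :
    (∀ᵐ x : ℝ ∂volume.restrict (Ioi (0 : ℝ)), ∃ v : ℂ, HasPVIntegral (k x) x v ∧
        1 / (x : ℂ) * f (1 / x) = 2 / (Real.pi : ℂ) * v) ↔
      ∀ᵐ ξ, mellinL2 hf (-ξ) * D (-ξ) = mellinL2 hf ξ * D ξ := by
  have hπ : ∀ z : ℂ, 2 / (Real.pi : ℂ) * (Real.pi / 2 * z) = z := fun z => by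
    have : (Real.pi : ℂ) ≠ 0 := Complex.ofReal_ne_zero.2 Real.pi_ne_zero
    field_simp
  calc (∀ᵐ x : ℝ ∂volume.restrict (Ioi (0 : ℝ)), ∃ v : ℂ, HasPVIntegral (k x) x v ∧
          1 / (x : ℂ) * f (1 / x) = 2 / (Real.pi : ℂ) * v)
      ↔ ∀ᵐ x : ℝ ∂volume.restrict (Ioi (0 : ℝ)), 1 / (x : ℂ) * f (1 / x) = w x := by
        refine eventually_congr (hPV.mono fun x hx => ⟨?_, fun h => ⟨_, hx, by rw [h, hπ]⟩⟩)
        rintro ⟨v, hv, h⟩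
        rw [h, hv.unique hx, hπ]
    _ ↔ ∀ᵐ ξ, mellinL2 hf (-ξ) = mellinL2 hw ξ := one_div_mul_comp_one_div_ae_eq_iff hf hw
    _ ↔ ∀ᵐ ξ, mellinL2 hf (-ξ) * D (-ξ) = mellinL2 hf ξ * D ξ :=
      eventually_congr (hmul.mono fun ξ h => by rw [h, mul_left_inj' (hD0 (-ξ))])

theorem reflected_equation_iff_second_kind_equation {k' : ℝ → ℝ → ℂ}
    (hk : ∀ x : ℝ, 0 < x → ∀ t, k (1 / x) t = x * k' x t) (f : ℝ → ℂ) :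
    (∀ᵐ x : ℝ ∂volume.restrict (Ioi (0 : ℝ)), ∃ v : ℂ, HasPVIntegral (k x) x v ∧
        1 / (x : ℂ) * f (1 / x) = 2 / (Real.pi : ℂ) * v) ↔
      ∀ᵐ x : ℝ ∂volume.restrict (Ioi (0 : ℝ)), ∃ v : ℂ, HasPVIntegral (k' x) (1 / x) v ∧
        f x = 2 / (Real.pi : ℂ) * v := by
  rw [← ae_Ioi_one_div_iff]
  refine eventually_congr ?_
  filter_upwards [ae_restrict_mem measurableSet_Ioi] with x (hx : 0 < x)
  have hx0 : (x : ℂ) ≠ 0 := Complex.ofReal_ne_zero.2 hx.ne'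
  have hsurj : Function.Surjective fun v : ℂ => x * v := fun v => ⟨_, mul_inv_cancel_left₀ hx0 v⟩
  have hlhs : 1 / ((1 / x : ℝ) : ℂ) * f (1 / (1 / x)) = x * f x := by
    rw [Complex.ofReal_div, Complex.ofReal_one, one_div_one_div, one_div_one_div]
  rw [funext (hk x hx), hsurj.exists, hlhs]
  refine exists_congr fun v => and_congr (HasPVIntegral.const_mul_iff hx0) ?_
  rw [mul_left_comm, mul_right_inj' hx0]

theorem ofReal_sub_ne_zero_and_add_ne_zero {x t : ℝ} (hx : 0 < x) (ht : 0 < t) (h : t ≠ x) :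
    (x : ℂ) - t ≠ 0 ∧ (x : ℂ) + t ≠ 0 :=
  ⟨sub_ne_zero.2 (Complex.ofReal_injective.ne h.symm), by
    exact_mod_cast (add_pos hx ht).ne'⟩

theorem solvesReflectedCot_iff_mellinL2 (hf : MemL2HalfLine f) :
    SolvesReflectedCot f ↔
      ∀ᵐ ξ, mellinL2 hf (-ξ) * critCos (-ξ) = mellinL2 hf ξ * critCos ξ := by
  set a := parityLp (-1) hf
  have hodd : ∀ᵐ t, a (-t) = -1 * a t := parityLp_neg_ae_eq (by norm_num) hf
  have hw : MemLp (fun x => -hilbertL2 a x) 2 := (Lp.memLp (hilbertL2 a)).neg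
  refine reflected_equation_iff_mellinL2 hf (hw.restrict _) ?_ critCos_ne_zero ?_
  · filter_upwards [ae_hasPVIntegral_hilbertL2_parityLp (-1) hf, ae_restrict_mem measurableSet_Ioi]
      with x hx hx0
    convert (hx.const_mul (-1 / 2)).congr fun t ht htx => ?_ using 1
    · ring
    · obtain ⟨hsub, hadd⟩ := ofReal_sub_ne_zero_and_add_ne_zero hx0 ht htx
      rw [show (t : ℂ) ^ 2 - x ^ 2 = -((x - t) * (x + t)) by ring]
      field_simp
      ring
  · refine mellinL2_mul_critCos_ae_eq hf _ fun ε hε => ?_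
    rw [← setIntegral_parityLp_mul (-1) hf]
    refine setIntegral_mul_conjPoissonKer_eq (Lp.memLp a) hw ?_ ?_ hε ?_
    · filter_upwards [hodd] with t ht
      rw [ht, neg_one_mul]
    · filter_upwards [hilbertL2_neg_ae_eq hodd] with t ht
      rw [ht, neg_neg, one_mul]
    · simp only [neg_mul, integral_neg, neg_neg]
      exact integral_mul_conjPoissonKer_eq_hilbertL2 a hε 0

theorem solvesReflectedTan_iff_mellinL2 (hf : MemL2HalfLine f) :
    SolvesReflectedTan f ↔
      ∀ᵐ ξ, mellinL2 hf (-ξ) * critCos (- -ξ) = mellinL2 hf ξ * critCos (-ξ) := by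
  set a := parityLp 1 hf
  have heven : ∀ᵐ t, a (-t) = 1 * a t := parityLp_neg_ae_eq (one_mul 1) hf
  have hw : MemLp (hilbertL2 a) 2 := Lp.memLp _
  refine reflected_equation_iff_mellinL2 hf (hw.restrict _) (D := fun ξ => critCos (-ξ)) ?_
    (fun ξ => critCos_ne_zero (-ξ)) ?_
  · filter_upwards [ae_hasPVIntegral_hilbertL2_parityLp 1 hf, ae_restrict_mem measurableSet_Ioi]
      with x hx hx0
    convert (hx.const_mul (1 / 2)).congr fun t ht htx => ?_ using 1
    · ring
    · obtain ⟨hsub, hadd⟩ := ofReal_sub_ne_zero_and_add_ne_zero hx0 ht htx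
      rw [show (x : ℂ) ^ 2 - t ^ 2 = (x - t) * (x + t) by ring]
      field_simp
      ring
  · simp only [neg_neg]
    refine (mellinL2_mul_critCos_ae_eq (hw.restrict _) hf fun ε hε => ?_).mono fun ξ => Eq.symm
    rw [← setIntegral_parityLp_mul 1 hf]
    refine setIntegral_mul_conjPoissonKer_eq hw (Lp.memLp a) ?_ ?_ hε ?_
    · filter_upwards [hilbertL2_neg_ae_eq heven] with t ht
      rw [ht, neg_one_mul]
    · filter_upwards [heven] with t ht
      rw [ht, one_mul]
    · exact integral_hilbertL2_mul_conjPoissonKer_eq a hε 0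

theorem solvesReflectedCot_iff_solvesSecondKindCot (f : ℝ → ℂ) :
    SolvesReflectedCot f ↔ SolvesSecondKindCot f :=
  reflected_equation_iff_second_kind_equation (fun x hx t => by
    have hx0 : (x : ℂ) ≠ 0 := Complex.ofReal_ne_zero.2 hx.ne'
    have hden : (t : ℂ) ^ 2 - ((1 / x : ℝ) : ℂ) ^ 2 =
        ((x : ℂ) ^ 2 * (t : ℂ) ^ 2 - 1) / (x : ℂ) ^ 2 := by
      push_cast
      field_simp
    rw [hden, div_div_eq_mul_div]
    ring) f

theorem solvesReflectedTan_iff_solvesSecondKindTan (f : ℝ → ℂ) :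
    SolvesReflectedTan f ↔ SolvesSecondKindTan f :=
  reflected_equation_iff_second_kind_equation (fun x hx t => by
    have hx0 : (x : ℂ) ≠ 0 := Complex.ofReal_ne_zero.2 hx.ne'
    have hden : ((1 / x : ℝ) : ℂ) ^ 2 - (t : ℂ) ^ 2 =
        (1 - (x : ℂ) ^ 2 * (t : ℂ) ^ 2) / (x : ℂ) ^ 2 := by
      push_cast
      field_simp
    rw [hden, div_div_eq_mul_div]
    push_cast
    field_simp) f

end ReflectedEquation

theorem corollary2 (f : ℝ → ℂ) (hf : MemL2HalfLine f) :
    List.TFAE [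
      SolvesReflectedCot f,
      SolvesSecondKindCot f,
      ∃ φ : ℂ → ℂ, SymmetricOnCritLine φ ∧
        IsMeanSquareMellinIntegral (fun s => φ s / Complex.cos ((Real.pi : ℂ) * s / 2)) f,
      ∃ φ : ℂ → ℂ, SymmetricOnCritLine φ ∧
        IsMellinTransformL2 f (fun s => φ s / Complex.cos ((Real.pi : ℂ) * s / 2))] ∧
    List.TFAE [
      SolvesReflectedTan f,
      SolvesSecondKindTan f,
      ∃ ρ : ℂ → ℂ, SymmetricOnCritLine ρ ∧
        IsMeanSquareMellinIntegral (fun s => ρ s / Complex.sin ((Real.pi : ℂ) * s / 2)) f,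
      ∃ ρ : ℂ → ℂ, SymmetricOnCritLine ρ ∧
        IsMellinTransformL2 f (fun s => ρ s / Complex.sin ((Real.pi : ℂ) * s / 2))] := by
  constructor
  · exact tfae_mellin_conditions (den := fun s => Complex.cos (Real.pi * s / 2)) hf
      (fun _ => rfl) critCos_ne_zero (solvesReflectedCot_iff_mellinL2 hf)
      (solvesReflectedCot_iff_solvesSecondKindCot f)
  · exact tfae_mellin_conditions (den := fun s => Complex.sin (Real.pi * s / 2)) hf
      (fun ξ => (critCos_neg ξ).symm) (fun ξ => critCos_ne_zero (-ξ))
      (solvesReflectedTan_iff_mellinL2 hf)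
      (solvesReflectedTan_iff_solvesSecondKindTan f)
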